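/- Let $S_l,S_u\subset\mathbb R$ be finite sets and let $p\in\{1,2\}$. There is a constant $C>0$, depending only on $S_l$, $S_u$ and $p$, such that the following holds for all $n,d\ge 1$, all reals $a<b$, all $\varepsilon\in(0,1)$, every product distribution $\mathcal D=\prod_{i=1}^d\mathcal D_i$ on $[n]^d$, and every bounding family $\mathbf B=\{l_i:[n-1]\to S_l,\ u_i:[n-1]\to S_u\}_{i=1}^d$ (that is, $l_i(y)<u_i(y)$ for all $i\in[d]$, $y\in[n-1]$). Let $\mathcal P(\mathbf B)$ be the set of all $f:[n]^d\to\mathbb R$ with $l_r(x_r)\le f(x+\mathbf e_r)-f(x)\le u_r(x_r)$ for every $r\in[d]$ and every $x\in[n]^d$ with $x_r<n$. For $f:[n]^d\to[a,b]$ define its normalized $L_p$-distance to $\mathcal P(\mathbf B)$ by $$\mathrm{dist}_p(f,\mathcal P(\mathbf B))=\frac1{b-a}\,\inf_{g\in\mathcal P(\mathbf B)}\Big(\mathbf E_{x\sim\mathcal D}\,|f(x)-g(x)|^p\Big)^{1/p}.$$ Then there is an $L_p$-tester for $\mathcal P(\mathbf B)$ with worst-case running time at most $C\,d/\varepsilon^p$: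 a randomized, possibly adaptive, algorithm with oracle access to an unknown $f:[n]^d\to[a,b]$ that - accepts with probability at least $2/3$ if $f\in\mathcal P(\mathbf B)$, and - rejects with probability at least $2/3$ if $\mathrm{dist}_p(f,\mathcal P(\mathbf B))>\varepsilon$. Here $n,d,a,b,\varepsilon,\mathcal D,\mathbf B$ are known to the algorithm (they may be built into it), and each of the following operations takes one unit of time: querying $f$ at a point and storing the answer in a real register; loading a real constant into a register; one arithmetic operation ($+,-,\times,/$) on registers; branching on a comparison of two registers; flipping a coin whose bias is the content of a register; and drawing an outcome from a known distribution on a finite set. -/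

import Mathlib

namespace LpTesting

/-- The hypergrid `[n]^d`. -/
abbrev Grid (n d : ℕ) : Type := Fin d → Fin n

/-- A bounding family: functions `l_r, u_r : [n-1] → ℝ`, one pair for each dimension `r`,
with `l_r(y) < u_r(y)` everywhere. -/
structure BoundingFamily (n d : ℕ) where
  lower : Fin d → Fin (n - 1) → ℝ
  upper : Fin d → Fin (n - 1) → ℝ
  lower_lt_upper : ∀ r y, lower r y < upper r y

/-- The point `x + e_r`, for a point `x` whose `r`-th coordinate is not the last one. -/
def Grid.succ {n d : ℕ} (x : Grid n d) (r : Fin d) (h : (x r : ℕ) + 1 < n) : Grid n d :=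
  Function.update x r ⟨(x r : ℕ) + 1, h⟩

/-- The property `P(B)`: the set of all `f : [n]^d → ℝ` whose discrete derivative
`∂_r f (x) = f (x + e_r) - f (x)` lies between `l_r(x_r)` and `u_r(x_r)`,
for every edge `(x, x + e_r)` of the grid. -/
def BoundingFamily.property {n d : ℕ} (B : BoundingFamily n d) : Set (Grid n d → ℝ) :=
  {f | ∀ (r : Fin d) (x : Grid n d) (h : (x r : ℕ) + 1 < n),
    B.lower r ⟨x r, Nat.lt_sub_of_add_lt h⟩ ≤ f (x.succ r h) - f x ∧
      f (x.succ r h) - f x ≤ B.upper r ⟨x r, Nat.lt_sub_of_add_lt h⟩}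

/-- The mass of the point `x` under the product distribution `∏ i, D i`. -/
noncomputable def prodMass {n d : ℕ} (D : Fin d → PMF (Fin n)) (x : Grid n d) : ℝ :=
  ∏ i, (D i (x i)).toReal

/-- The `L_p`-distance of `f` and `g` with respect to the product distribution, normalized by
the length of the range `[a, b]`: `(E |f - g| ^ p) ^ (1 / p) / (b - a)`. -/
noncomputable def lpDist {n d : ℕ} (p : ℕ) (a b : ℝ) (D : Fin d → PMF (Fin n))
    (f g : Grid n d → ℝ) : ℝ :=
  1 / (b - a) * (∑ x, prodMass D x * |f x - g x| ^ p) ^ (1 / (p : ℝ))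

/-- The `L_p`-distance of `f` to the property `P`: the infimum of the distances to members. -/
noncomputable def lpDistTo {n d : ℕ} (p : ℕ) (a b : ℝ) (D : Fin d → PMF (Fin n))
    (P : Set (Grid n d → ℝ)) (f : Grid n d → ℝ) : ℝ :=
  ⨅ g : P, lpDist p a b D f g

/-- The arithmetic operations on reals. -/
inductive Op
  | add
  | sub
  | mul
  | div

/-- The value of an arithmetic operation. -/
noncomputable def Op.eval : Op → ℝ → ℝ → ℝ
  | .add, s, t => s + t
  | .sub, s, t => s - t
  | .mul, s, t => s * t
  | .div, s, t => s / t

/-- Randomized adaptive algorithms with oracle access to a function `f : X → ℝ`, as randomized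
algebraic computation trees over real registers numbered by `ℕ`.
Each instruction other than halting takes one unit of time.
* `accept`, `reject`: halt with that verdict;
* `query x k`: put `f x` into register `k`;
* `const c k`: put the constant `c` into register `k`;
* `arith op i j k`: put the result of `op` on registers `i`, `j` into register `k`;
* `branch i j`: go to the first subtree if register `i` is at most register `j`, otherwise to
  the second one;
* `coin i`: go to the first subtree with probability the content of register `i`
  (truncated to `[0, 1]`), otherwise to the second one;
* `sample ν`: draw one of finitely many outcomes with the distribution `ν`, independently of all
  previous draws, and go to the subtree for that outcome. -/
inductive Algo (X : Type) : Type
  | accept : Algo X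
  | reject : Algo X
  | query (x : X) (k : ℕ) (next : Algo X) : Algo X
  | const (c : ℝ) (k : ℕ) (next : Algo X) : Algo X
  | arith (op : Op) (i j k : ℕ) (next : Algo X) : Algo X
  | branch (i j : ℕ) (le gt : Algo X) : Algo X
  | coin (i : ℕ) (heads tails : Algo X) : Algo X
  | sample {m : ℕ} (ν : PMF (Fin m)) (next : Fin m → Algo X) : Algo X

/-- The worst-case running time: the largest number of instructions executed on any path. -/
def Algo.time {X : Type} : Algo X → ℕ
  | .accept => 0
  | .reject => 0
  | .query _ _ next => next.time + 1
  | .const _ _ next => next.time + 1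
  | .arith _ _ _ _ next => next.time + 1
  | .branch _ _ le gt => max le.time gt.time + 1
  | .coin _ heads tails => max heads.time tails.time + 1
  | .sample _ next => (Finset.univ.sup fun o => (next o).time) + 1

/-- A coin that shows `true` with probability `t`, truncated to `[0, 1]`. -/
noncomputable def coinFlip (t : ℝ) : PMF Bool :=
  PMF.ofFintype (fun c => ENNReal.ofReal (cond c (max 0 (min t 1)) (1 - max 0 (min t 1)))) (by
    have h1 : max 0 (min t 1) ≤ 1 := max_le zero_le_one (min_le_right t 1)
    rw [Fintype.sum_bool, cond_true, cond_false,
      ← ENNReal.ofReal_add (le_max_left 0 (min t 1)) (sub_nonneg.2 h1)]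
    simp)

/-- The distribution of the verdict (`true` is acceptance) of an algorithm with oracle `f`,
started with the register contents `s`. -/
noncomputable def Algo.run {X : Type} (f : X → ℝ) : Algo X → (ℕ → ℝ) → PMF Bool
  | .accept, _ => PMF.pure true
  | .reject, _ => PMF.pure false
  | .query x k next, s => next.run f (Function.update s k (f x))
  | .const c k next, s => next.run f (Function.update s k c)
  | .arith op i j k next, s => next.run f (Function.update s k (op.eval (s i) (s j)))
  | .branch i j le gt, s =>
      haveI := Classical.propDecidable (s i ≤ s j)
      if s i ≤ s j then le.run f s else gt.run f s
  | .coin i heads tails, s =>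
      (coinFlip (s i)).bind fun c =>
        if c then heads.run f s else tails.run f s
  | .sample ν next, s => ν.bind fun o => (next o).run f s

/-- The distribution of the verdict of an algorithm with oracle `f`; all registers start
with `0`. -/
noncomputable def Algo.verdict {X : Type} (T : Algo X) (f : X → ℝ) : PMF Bool :=
  T.run f fun _ => 0

/-- `T` is an `L_p`-tester, with proximity parameter `ε`, for the property `P` of functions
`f : [n]^d → [a, b]` under the product distribution `∏ i, D i`: it accepts `f` with probability
at least `2/3` if `f ∈ P`, and rejects `f` with probability at least `2/3` if `f` is `ε`-far
from `P`. -/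
def IsLpTester {n d : ℕ} (p : ℕ) (a b ε : ℝ) (D : Fin d → PMF (Fin n))
    (P : Set (Grid n d → ℝ)) (T : Algo (Grid n d)) : Prop :=
  ∀ f : Grid n d → ℝ, (∀ x, f x ∈ Set.Icc a b) →
    (f ∈ P → 2 / 3 ≤ (T.verdict f true).toReal) ∧
    (ε < lpDistTo p a b D P f → 2 / 3 ≤ (T.verdict f false).toReal)

end LpTesting

/-! Membership in the property is a conjunction of `2 * d` one-sided constraints: in each dimension,
`f` minus the cumulated lower bounds, and the cumulated upper bounds minus `f`, are monotone on
every line. Weighted isotonic regression on all lines repairs one constraint. It preserves order and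
weighted sums and commutes with adding constants, so it contracts the L₁-distance and keeps the
constraints of all other dimensions; since lower bounds lie below upper bounds, it also keeps the
opposite constraint of the same dimension (`sat_repair_of_sat`). Hence the L₁-distance to the
property is at most twice the sum of the distances to the single constraints
(`exists_sat_l1Dist_le`).

A single constraint is tested on a random line. Fix a member `m` of the property with values in `[a,
b]`. Then `|f - m| ≤ b - a`, so at each point only `M` thresholds of spacing `η` are in doubt,
however large the cumulated bounds are. For a random point and a random threshold in doubt there, a
binary search through weighted medians forces a value at the point; the trial fails if the true
value differs. The forced values are monotone whatever `f` is. Adding them up over the thresholds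
gives a monotone function whose mean distance from `f` is at most `η` plus `η * M` times the failure
probability (`exists_monotone_abs_sub_le`). Each median halves the undecided weight, so a search
takes at most two queries on average (`sum_searchDepth_le`).

So for an `ε`-far `f` a trial fails with probability of order `ε ^ p / d`, and `O(d / ε ^ p)` trials
of bounded expected cost suffice, with a cut-off justified by Markov's inequality. The case `p = 2`
reduces to L₁ because the repaired function stays within `2 * (b - a)` of `f`. -/

namespace LpTesting

/-! ### Weighted isotonic regression on a chain -/

/-- `p` is the weighted isotonic regression of `ψ`: the projection of `ψ` to the monotone functions
in the weighted `L₂`-norm, given by its variational inequality. -/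
def IsIsoReg {n : ℕ} (w ψ p : Fin n → ℝ) : Prop :=
  Monotone p ∧ ∀ q : Fin n → ℝ, Monotone q → ∑ k, w k * ((ψ k - p k) * (q k - p k)) ≤ 0

/-- The weighted isotonic regression of `ψ`. -/
noncomputable def isoReg {n : ℕ} (w ψ : Fin n → ℝ) : Fin n → ℝ :=
  Classical.epsilon (IsIsoReg w ψ)

section
variable {n : ℕ} {w : Fin n → ℝ}

/-- Scaling by `√w` turns the weighted norm into the Euclidean one, where the regression is the
projection to a closed convex cone. -/
theorem exists_isIsoReg (hw : ∀ k, 0 < w k) (ψ : Fin n → ℝ) : ∃ p, IsIsoReg w ψ p := by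
  have hs : ∀ k, 0 < √(w k) := fun k => Real.sqrt_pos.2 (hw k)
  let K : Set (EuclideanSpace ℝ (Fin n)) := {v | Monotone fun k => v k / √(w k)}
  have hne : K.Nonempty := ⟨0, by simp [K, monotone_const]⟩
  have hconv : Convex ℝ K := by
    intro u hu v hv s t hs ht _ i j hij
    have h1 := mul_le_mul_of_nonneg_left (hu hij) hs
    have h2 := mul_le_mul_of_nonneg_left (hv hij) ht
    simp only [PiLp.add_apply, PiLp.smul_apply, smul_eq_mul, add_div, mul_div_assoc]
    linarith
  have hcl : IsClosed K := by
    have : K = ⋂ i, ⋂ j, ⋂ _ : i ≤ j,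
        {v : EuclideanSpace ℝ (Fin n) | v i / √(w i) ≤ v j / √(w j)} := by
      ext v; simp [K, Monotone]
    rw [this]
    refine isClosed_iInter fun i => isClosed_iInter fun j => isClosed_iInter fun _ => ?_
    exact isClosed_le (by fun_prop) (by fun_prop)
  obtain ⟨v, hv, hmin⟩ := exists_norm_eq_iInf_of_complete_convex hne hcl.isComplete hconv
    (WithLp.toLp 2 fun k => √(w k) * ψ k)
  refine ⟨fun k => v k / √(w k), hv, fun q hq => ?_⟩
  have := (norm_eq_iInf_iff_real_inner_le_zero hconv hv).1 hmin
    (WithLp.toLp 2 fun k => √(w k) * q k) (by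
      intro i j hij
      simpa [mul_div_cancel_left₀ _ (hs _).ne'] using hq hij)
  refine le_trans (le_of_eq ?_) this
  simp only [PiLp.inner_apply, PiLp.sub_apply]
  refine Finset.sum_congr rfl fun k _ => ?_
  have h1 : w k = √(w k) * √(w k) := (Real.mul_self_sqrt (hw k).le).symm
  have h2 : v k = √(w k) * (v k / √(w k)) := by field_simp [(hs k).ne']
  generalize v k / √(w k) = y at h2 ⊢
  rw [h2]
  conv_lhs => rw [h1]
  simp
  ring

theorem isoReg_spec (hw : ∀ k, 0 < w k) (ψ : Fin n → ℝ) : IsIsoReg w ψ (isoReg w ψ) :=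
  Classical.epsilon_spec (exists_isIsoReg hw ψ)

theorem isoReg_monotone (hw : ∀ k, 0 < w k) (ψ : Fin n → ℝ) : Monotone (isoReg w ψ) :=
  (isoReg_spec hw ψ).1

/-- Testing `p` against `p ⊓ p'` and `p'` against `p ⊔ p'` and adding bounds the weighted square sum
of the positive part of `p - p'` by zero. With `ψ = ψ'` this is also uniqueness. -/
theorem IsIsoReg.mono (hw : ∀ k, 0 < w k) {ψ ψ' p p' : Fin n → ℝ} (h : IsIsoReg w ψ p)
    (h' : IsIsoReg w ψ' p') (hle : ψ ≤ ψ') : p ≤ p' := by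
  have h1 := h.2 (p ⊓ p') (h.1.inf h'.1)
  have h2 := h'.2 (p ⊔ p') (h.1.sup h'.1)
  have key : ∑ k, w k * (max (p k - p' k) 0) ^ 2 ≤ 0 := by
    refine le_trans ?_ (add_nonpos h1 h2)
    rw [← Finset.sum_add_distrib]
    refine Finset.sum_le_sum fun k _ => ?_
    rw [← mul_add]
    refine mul_le_mul_of_nonneg_left ?_ (hw k).le
    have := hle k
    simp only [Pi.inf_apply, Pi.sup_apply]
    rcases le_total (p k) (p' k) with hk | hk
    · simp [hk]
    · rw [min_eq_right hk, max_eq_left hk, max_eq_left (sub_nonneg.2 hk)]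
      nlinarith
  intro k
  have h0 := (Finset.sum_eq_zero_iff_of_nonneg
    (fun k _ => mul_nonneg (hw k).le (sq_nonneg (max (p k - p' k) 0)))).1
    (le_antisymm key (Finset.sum_nonneg fun k _ => mul_nonneg (hw k).le (sq_nonneg _)))
    k (Finset.mem_univ k)
  have h3 : max (p k - p' k) 0 = 0 := by simpa [(hw k).ne'] using h0
  have := le_max_left (p k - p' k) 0
  linarith

theorem IsIsoReg.eq_isoReg (hw : ∀ k, 0 < w k) {ψ p : Fin n → ℝ} (h : IsIsoReg w ψ p) :
    isoReg w ψ = p :=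
  le_antisymm ((isoReg_spec hw ψ).mono hw h le_rfl) (h.mono hw (isoReg_spec hw ψ) le_rfl)

theorem isoReg_mono (hw : ∀ k, 0 < w k) {ψ ψ' : Fin n → ℝ} (h : ψ ≤ ψ') :
    isoReg w ψ ≤ isoReg w ψ' :=
  (isoReg_spec hw ψ).mono hw (isoReg_spec hw ψ') h

theorem isoReg_of_monotone (hw : ∀ k, 0 < w k) {ψ : Fin n → ℝ} (h : Monotone ψ) :
    isoReg w ψ = ψ :=
  IsIsoReg.eq_isoReg hw ⟨h, fun q _ => by simp⟩

theorem isoReg_add_const (hw : ∀ k, 0 < w k) (ψ : Fin n → ℝ) (t : ℝ) :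
    isoReg w (fun k => ψ k + t) = fun k => isoReg w ψ k + t := by
  refine IsIsoReg.eq_isoReg hw ⟨(isoReg_monotone hw ψ).add_const t, fun q hq => ?_⟩
  refine le_trans (le_of_eq (Finset.sum_congr rfl fun k _ => ?_))
    ((isoReg_spec hw ψ).2 (fun k => q k - t) fun i j hij => sub_le_sub_right (hq hij) t)
  ring

theorem sum_isoReg (hw : ∀ k, 0 < w k) (ψ : Fin n → ℝ) :
    ∑ k, w k * isoReg w ψ k = ∑ k, w k * ψ k := by
  have h1 := (isoReg_spec hw ψ).2 (fun k => isoReg w ψ k + 1)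
    ((isoReg_monotone hw ψ).add_const 1)
  have h2 := (isoReg_spec hw ψ).2 (fun k => isoReg w ψ k + -1)
    ((isoReg_monotone hw ψ).add_const (-1))
  simp only [add_sub_cancel_left, mul_one, mul_neg, mul_sub, Finset.sum_sub_distrib,
    Finset.sum_neg_distrib] at h1 h2
  linarith

/-- Isotonic regression is a contraction in the weighted `L₁`-norm. -/
theorem sum_abs_isoReg_sub_le (hw : ∀ k, 0 < w k) (ψ ψ' : Fin n → ℝ) :
    ∑ k, w k * |isoReg w ψ k - isoReg w ψ' k| ≤ ∑ k, w k * |ψ k - ψ' k| := by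
  -- An order-preserving map that preserves weighted sums is an L₁-contraction: both images lie
  -- between those of the meet and the join.
  have h1 := isoReg_mono hw (inf_le_left : ψ ⊓ ψ' ≤ ψ)
  have h2 := isoReg_mono hw (inf_le_right : ψ ⊓ ψ' ≤ ψ')
  have h3 := isoReg_mono hw (le_sup_left : ψ ≤ ψ ⊔ ψ')
  have h4 := isoReg_mono hw (le_sup_right : ψ' ≤ ψ ⊔ ψ')
  calc ∑ k, w k * |isoReg w ψ k - isoReg w ψ' k|
      ≤ ∑ k, (w k * isoReg w (ψ ⊔ ψ') k - w k * isoReg w (ψ ⊓ ψ') k) := by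
        refine Finset.sum_le_sum fun k _ => ?_
        rw [← mul_sub]
        refine mul_le_mul_of_nonneg_left ?_ (hw k).le
        have := h1 k; have := h2 k; have := h3 k; have := h4 k
        exact abs_sub_le_iff.2 ⟨by linarith, by linarith⟩
    _ = ∑ k, w k * |ψ k - ψ' k| := by
        rw [Finset.sum_sub_distrib, sum_isoReg hw, sum_isoReg hw, ← Finset.sum_sub_distrib]
        refine Finset.sum_congr rfl fun k _ => ?_
        rw [← mul_sub, Pi.sup_apply, Pi.inf_apply, max_sub_min_eq_abs, abs_sub_comm]

/-- Isotonic regression does not create increments above those of a monotone function. -/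
theorem monotone_sub_isoReg (hw : ∀ k, 0 < w k) {ψ e : Fin n → ℝ} (he : Monotone e)
    (h : Monotone (e - ψ)) : Monotone (e - isoReg w ψ) := by
  cases n with
  | zero => exact fun i => i.elim0
  | succ n =>
    have hm := isoReg_monotone hw ψ
    have hV := (isoReg_spec hw ψ).2
    set p := isoReg w ψ
    refine Fin.monotone_iff_le_succ.2 fun i => ?_
    by_contra! hlt
    have hei := he i.castSucc_le_succ
    have hi := h i.castSucc_le_succ
    simp only [Pi.sub_apply] at hlt hi
    have hpos : p i.castSucc < p i.succ := by linarith
    -- Where `p` jumps, either endpoint can be moved to the other value without losing monotonicity.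
    -- The variational inequality then shows that `ψ` jumps at least as much as `p`, hence more than
    -- `e`.
    have single : ∀ (j : Fin (n + 1)) (t : ℝ), Monotone (Function.update p j t) →
        (ψ j - p j) * (t - p j) ≤ 0 := by
      intro j t hj
      have := hV _ hj
      rw [Finset.sum_eq_single j (fun k _ hk => by simp [hk]) (by simp)] at this
      simp only [Function.update_self] at this
      exact nonpos_of_mul_nonpos_right this (hw j)
    have h1 := single i.castSucc (p i.succ) (by
      intro j k hjk
      simp only [Function.update_apply]
      split_ifs with h1 h2 h2
      · exact le_rfl
      · exact hm (Fin.castSucc_lt_iff_succ_le.1 (lt_of_le_of_ne (h1 ▸ hjk) (Ne.symm h2)))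
      · exact hm (hjk.trans (h2 ▸ i.castSucc_le_succ))
      · exact hm hjk)
    have h2 := single i.succ (p i.castSucc) (by
      intro j k hjk
      simp only [Function.update_apply]
      split_ifs with h1 h2 h2
      · exact le_rfl
      · exact hm ((h1 ▸ i.castSucc_le_succ).trans hjk)
      · exact hm (Fin.le_castSucc_iff.2 (lt_of_le_of_ne (h2 ▸ hjk) h1))
      · exact hm hjk)
    have h3 : ψ i.castSucc ≤ p i.castSucc := by nlinarith
    have h4 : p i.succ ≤ ψ i.succ := by nlinarith
    linarith

end

/-! ### One-sided constraints and their repair -/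

/-- The sign encoded by a Boolean. -/
def sgn (s : Bool) : ℝ := if s then 1 else -1

theorem sgn_mul_sgn (s : Bool) : sgn s * sgn s = 1 := by cases s <;> simp [sgn]

theorem abs_sgn (s : Bool) : |sgn s| = 1 := by cases s <;> simp [sgn]

theorem sgn_not (s : Bool) : sgn (!s) = -sgn s := by cases s <;> simp [sgn]

theorem sgn_mul_sgn_mul (s : Bool) (t : ℝ) : sgn s * (sgn s * t) = t := by
  rw [← mul_assoc, sgn_mul_sgn, one_mul]

section
variable {n d : ℕ}

/-- The weight of a point for real weights on the coordinates. -/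
def weight (w : Fin d → Fin n → ℝ) (x : Grid n d) : ℝ := ∏ i, w i (x i)

/-- The weighted `L₁`-distance. -/
def l1Dist (w : Fin d → Fin n → ℝ) (f g : Grid n d → ℝ) : ℝ := ∑ x, weight w x * |f x - g x|

/-- The function `f` on the line through `x` in dimension `r`, with sign `s` and with the
function `c r s` subtracted. -/
def lineFun (c : Fin d → Bool → Fin n → ℝ) (r : Fin d) (s : Bool) (f : Grid n d → ℝ)
    (x : Grid n d) (k : Fin n) : ℝ :=
  sgn s * f (Function.update x r k) - c r s k

/-- The one-sided constraint in dimension `r`. -/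
def Sat (c : Fin d → Bool → Fin n → ℝ) (r : Fin d) (s : Bool) (f : Grid n d → ℝ) : Prop :=
  ∀ x, Monotone (lineFun c r s f x)

/-- The operator repairing a one-sided constraint by isotonic regression on each line. -/
noncomputable def repair (w : Fin d → Fin n → ℝ) (c : Fin d → Bool → Fin n → ℝ) (r : Fin d)
    (s : Bool) (f : Grid n d → ℝ) (x : Grid n d) : ℝ :=
  sgn s * (isoReg (w r) (lineFun c r s f x) (x r) + c r s (x r))

variable {w : Fin d → Fin n → ℝ} {c : Fin d → Bool → Fin n → ℝ}

theorem lineFun_update (r : Fin d) (s : Bool) (f : Grid n d → ℝ) (x : Grid n d) (k : Fin n) :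
    lineFun c r s f (Function.update x r k) = lineFun c r s f x := by
  funext j; simp [lineFun]

theorem lineFun_self (r : Fin d) (s : Bool) (f : Grid n d → ℝ) (x : Grid n d) :
    lineFun c r s f x (x r) = sgn s * f x - c r s (x r) := by
  simp [lineFun]

theorem repair_update (r : Fin d) (s : Bool) (f : Grid n d → ℝ) (x : Grid n d) (k : Fin n) :
    repair w c r s f (Function.update x r k) =
      sgn s * (isoReg (w r) (lineFun c r s f x) k + c r s k) := by
  simp [repair, lineFun_update]

theorem lineFun_repair (r : Fin d) (s : Bool) (f : Grid n d → ℝ) (x : Grid n d) :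
    lineFun c r s (repair w c r s f) x = isoReg (w r) (lineFun c r s f x) := by
  funext k
  rw [lineFun, repair_update, sgn_mul_sgn_mul, add_sub_cancel_right]

theorem sat_repair (hw : ∀ r k, 0 < w r k) (r : Fin d) (s : Bool) (f : Grid n d → ℝ) :
    Sat c r s (repair w c r s f) := fun x => by
  rw [lineFun_repair]; exact isoReg_monotone (hw r) _

theorem repair_of_sat (hw : ∀ r k, 0 < w r k) {r : Fin d} {s : Bool} {f : Grid n d → ℝ}
    (h : Sat c r s f) : repair w c r s f = f := by
  funext x
  rw [repair, isoReg_of_monotone (hw r) (h x), lineFun_self, sub_add_cancel, sgn_mul_sgn_mul]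

/-- Two lines in the same dimension that differ by at most `t` still do so after the repair. -/
theorem repair_le_add (hw : ∀ r k, 0 < w r k) (r : Fin d) (s : Bool) {f g : Grid n d → ℝ}
    {x y : Grid n d} {t : ℝ} (hxy : x r = y r)
    (h : ∀ k, f (Function.update x r k) ≤ g (Function.update y r k) + t) :
    repair w c r s f x ≤ repair w c r s g y + t := by
  have main : ∀ ψ ψ' : Fin n → ℝ, (∀ k, ψ k ≤ ψ' k + t) →
      ∀ k, isoReg (w r) ψ k ≤ isoReg (w r) ψ' k + t := by
    intro ψ ψ' h k
    have := isoReg_mono (hw r) (show ψ ≤ fun k => ψ' k + t from h) k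
    rwa [isoReg_add_const (hw r)] at this
  cases s with
  | true =>
    have := main (lineFun c r true f x) (lineFun c r true g y) (fun k => by
      have := h k
      simp only [lineFun, sgn, if_true]; linarith) (y r)
    simp only [repair, sgn, if_true, hxy]; linarith
  | false =>
    have := main (lineFun c r false g y) (lineFun c r false f x) (fun k => by
      have := h k
      simp only [lineFun, sgn]; simp; linarith) (y r)
    simp only [repair, sgn, hxy]; simp; linarith

/-- For the opposite sign in the same dimension, the two line functions add up to the monotone
function `-(c r true + c r false)`, so `monotone_sub_isoReg` applies. In another dimension, the
constraint compares parallel lines up to a constant, and `repair_le_add` preserves such comparisons.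
-/
theorem sat_repair_of_sat (hw : ∀ r k, 0 < w r k)
    (hc : ∀ r, Antitone (c r true + c r false)) {r r' : Fin d} {s s' : Bool}
    {f : Grid n d → ℝ} (h : Sat c r' s' f) : Sat c r' s' (repair w c r s f) := by
  intro x
  rcases eq_or_ne r' r with rfl | hr
  · rcases Bool.eq_or_eq_not s' s with rfl | rfl
    · exact sat_repair hw _ _ f x
    · have he : Monotone fun k => -(c r' s k + c r' (!s) k) := by
        have := (hc r').neg
        cases s
        · simpa [add_comm] using! this
        · exact this
      have e1 : ∀ f', (fun k => -(c r' s k + c r' (!s) k)) - lineFun c r' s f' x =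
          lineFun c r' (!s) f' x := by
        intro f'
        funext k
        simp only [Pi.sub_apply, lineFun, sgn_not]; ring
      have := monotone_sub_isoReg (hw r') he (ψ := lineFun c r' s f x) (by
        rw [e1]; exact h x)
      rwa [← lineFun_repair, e1] at this
  · intro k k' hk
    have hcomm : ∀ k j, Function.update (Function.update x r' k) r j =
        Function.update (Function.update x r j) r' k := fun k j =>
      Function.update_comm hr _ _ _
    have hj : ∀ j, sgn s' * f (Function.update (Function.update x r' k) r j) - c r' s' k ≤
        sgn s' * f (Function.update (Function.update x r' k') r j) - c r' s' k' := by
      intro j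
      rw [hcomm, hcomm]
      exact h (Function.update x r j) hk
    have hxr : ∀ k k', Function.update x r' k r = Function.update x r' k' r := by
      intro k k'; simp [Function.update_of_ne (Ne.symm hr)]
    show sgn s' * repair w c r s f _ - _ ≤ sgn s' * repair w c r s f _ - _
    cases s' with
    | true =>
      simp only [sgn, if_true, one_mul] at hj ⊢
      have := repair_le_add (c := c) hw r s (f := f) (g := f) (t := c r' true k - c r' true k')
        (hxr k k') (fun j => by linarith [hj j])
      linarith
    | false =>
      simp only [sgn, Bool.false_eq_true, if_false, neg_mul, one_mul] at hj ⊢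
      have := repair_le_add (c := c) hw r s (f := f) (g := f) (t := c r' false k - c r' false k')
        (hxr k' k) (fun j => by linarith [hj j])
      linarith

/-- The repair is nonexpansive in the sup norm and fixes `m`. This replaces clipping to `[a, b]`,
which need not respect the constraints. -/
theorem abs_repair_sub_le (hw : ∀ r k, 0 < w r k) {r : Fin d} {s : Bool} {f m : Grid n d → ℝ}
    {R : ℝ} (hm : Sat c r s m) (h : ∀ x, |f x - m x| ≤ R) (x : Grid n d) :
    |repair w c r s f x - m x| ≤ R := by
  have h1 := repair_le_add (c := c) hw r s (f := f) (g := m) (x := x) (y := x) (t := R) rfl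
    fun k => by linarith [(abs_sub_le_iff.1 (h (Function.update x r k))).1]
  have h2 := repair_le_add (c := c) hw r s (f := m) (g := f) (x := x) (y := x) (t := R) rfl
    fun k => by linarith [(abs_sub_le_iff.1 (h (Function.update x r k))).2]
  rw [repair_of_sat hw hm] at h1 h2
  exact abs_sub_le_iff.2 ⟨by linarith, by linarith⟩

theorem weight_nonneg (hw : ∀ r k, 0 ≤ w r k) (x : Grid n d) : 0 ≤ weight w x :=
  Finset.prod_nonneg fun i _ => hw i _

theorem sum_weight (hw1 : ∀ r, ∑ k, w r k = 1) : ∑ x, weight w x = 1 := by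
  have := Finset.prod_univ_sum (fun _ : Fin d => (Finset.univ : Finset (Fin n))) w
  simp only [hw1, Finset.prod_const_one, Fintype.piFinset_univ] at this
  exact this.symm

theorem weight_update_mul (x : Grid n d) (r : Fin d) (k : Fin n) :
    weight w (Function.update x r k) * w r (x r) = weight w x * w r k := by
  unfold weight
  rw [← Finset.mul_prod_erase Finset.univ (fun i => w i (Function.update x r k i))
      (Finset.mem_univ r), ← Finset.mul_prod_erase Finset.univ (fun i => w i (x i))
      (Finset.mem_univ r)]
  have : ∏ i ∈ Finset.univ.erase r, w i (Function.update x r k i) =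
      ∏ i ∈ Finset.univ.erase r, w i (x i) :=
    Finset.prod_congr rfl fun i hi => by simp [Function.update_of_ne (Finset.ne_of_mem_erase hi)]
  rw [this, Function.update_self]
  ring

/-- Resampling one coordinate does not change the expectation. -/
theorem sum_weight_mul_resample (hw1 : ∀ r, ∑ k, w r k = 1) (r : Fin d) (F : Grid n d → ℝ) :
    ∑ x, weight w x * ∑ k, w r k * F (Function.update x r k) = ∑ x, weight w x * F x := by
  calc ∑ x, weight w x * ∑ k, w r k * F (Function.update x r k)
      = ∑ p : Grid n d × Fin n, weight w (Function.update p.1 r p.2) * w r (p.1 r) *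
          F (Function.update p.1 r p.2) := by
        rw [Fintype.sum_prod_type]
        refine Finset.sum_congr rfl fun x _ => ?_
        rw [Finset.mul_sum]
        refine Finset.sum_congr rfl fun k _ => ?_
        rw [weight_update_mul]; ring
    _ = ∑ p : Grid n d × Fin n, weight w p.1 * w r p.2 * F p.1 := by
        -- Exchanging the coordinate `x r` with the fresh sample is a weight-preserving involution.
        have hinv : Function.Involutive fun p : Grid n d × Fin n =>
            (Function.update p.1 r p.2, p.1 r) := by
          intro p; simp
        exact Equiv.sum_comp hinv.toPerm fun p => weight w p.1 * w r p.2 * F p.1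
    _ = ∑ x, weight w x * F x := by
        rw [Fintype.sum_prod_type]
        refine Finset.sum_congr rfl fun x _ => ?_
        dsimp only
        rw [← Finset.sum_mul, ← Finset.mul_sum, hw1, mul_one]

/-- Resampling coordinate `r` splits the distance into averages over lines, where isotonic
regression contracts. -/
theorem l1Dist_repair_le (hw : ∀ r k, 0 < w r k) (hw1 : ∀ r, ∑ k, w r k = 1) (r : Fin d)
    (s : Bool) (f g : Grid n d → ℝ) :
    l1Dist w (repair w c r s f) (repair w c r s g) ≤ l1Dist w f g := by
  unfold l1Dist
  rw [← sum_weight_mul_resample hw1 r, ← sum_weight_mul_resample hw1 r fun x => |f x - g x|]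
  refine Finset.sum_le_sum fun x _ =>
    mul_le_mul_of_nonneg_left ?_ (weight_nonneg (fun r k => (hw r k).le) x)
  have := sum_abs_isoReg_sub_le (hw r) (lineFun c r s f x) (lineFun c r s g x)
  refine le_trans (le_of_eq ?_) (this.trans (le_of_eq ?_))
  · refine Finset.sum_congr rfl fun k _ => ?_
    rw [repair_update, repair_update, ← mul_sub, abs_mul, abs_sgn, one_mul, add_sub_add_right_eq_sub]
  · refine Finset.sum_congr rfl fun k _ => ?_
    rw [lineFun, lineFun, sub_sub_sub_cancel_right, ← mul_sub, abs_mul, abs_sgn, one_mul]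

theorem l1Dist_triangle (hw : ∀ r k, 0 < w r k) (f g h : Grid n d → ℝ) :
    l1Dist w f h ≤ l1Dist w f g + l1Dist w g h := by
  unfold l1Dist
  rw [← Finset.sum_add_distrib]
  refine Finset.sum_le_sum fun x _ => ?_
  rw [← mul_add]
  exact mul_le_mul_of_nonneg_left (abs_sub_le _ _ _) (weight_nonneg (fun r k => (hw r k).le) x)

theorem l1Dist_comm (f g : Grid n d → ℝ) : l1Dist w f g = l1Dist w g f := by
  simp only [l1Dist, abs_sub_comm]

/-- Dimension reduction: if `f` is close to each of the one-sided constraints, then it is close to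
a function that satisfies all of them. -/
theorem exists_sat_l1Dist_le (hw : ∀ r k, 0 < w r k) (hw1 : ∀ r, ∑ k, w r k = 1)
    (hc : ∀ r, Antitone (c r true + c r false)) {m : Grid n d → ℝ} (hm : ∀ r s, Sat c r s m)
    {R : ℝ} (e : Fin d × Bool → ℝ) (J : Finset (Fin d × Bool)) :
    ∀ f : Grid n d → ℝ, (∀ x, |f x - m x| ≤ R) →
      (∀ j, ∃ g, Sat c j.1 j.2 g ∧ l1Dist w f g ≤ e j) →
      ∃ g, (∀ j ∈ J, Sat c j.1 j.2 g) ∧ (∀ j : Fin d × Bool, Sat c j.1 j.2 f → Sat c j.1 j.2 g) ∧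
        (∀ x, |g x - m x| ≤ R) ∧ l1Dist w f g ≤ 2 * ∑ j ∈ J, e j := by
  classical
  induction J using Finset.induction_on with
  | empty => exact fun f hf _ => ⟨f, by simp, fun _ h => h, hf, by simp [l1Dist]⟩
  | insert j J hj ih =>
    intro f hf he
    -- Repairing the nearby functions along with `f` shows that the distance bounds `e` persist for
    -- the repaired `f`.
    obtain ⟨g, h1, h2, h3, h4⟩ := ih (repair w c j.1 j.2 f)
      (abs_repair_sub_le hw (hm _ _) hf) (fun i => by
        obtain ⟨g, hg, hfg⟩ := he i
        exact ⟨repair w c j.1 j.2 g, sat_repair_of_sat hw hc hg,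
          (l1Dist_repair_le hw hw1 _ _ _ _).trans hfg⟩)
    refine ⟨g, ?_, fun i hi => h2 i (sat_repair_of_sat hw hc hi), h3, ?_⟩
    · intro i hi
      rcases Finset.mem_insert.1 hi with rfl | hi
      · exact h2 _ (sat_repair hw _ _ f)
      · exact h1 i hi
    · obtain ⟨g', hg', hfg'⟩ := he j
      have a1 := l1Dist_repair_le (c := c) hw hw1 j.1 j.2 g' f
      rw [repair_of_sat hw hg', l1Dist_comm g' f] at a1
      have a2 := l1Dist_triangle hw f g' (repair w c j.1 j.2 f)
      have a3 := l1Dist_triangle hw f (repair w c j.1 j.2 f) g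
      rw [Finset.sum_insert hj]
      linarith

/-! ### Bounded derivatives as one-sided constraints -/

/-- The sum of `t` over the positions before `k`. -/
def cumSum (t : Fin (n - 1) → ℝ) (k : Fin n) : ℝ := 
  ∑ y ∈ Finset.univ.filter (fun y : Fin (n - 1) => (y : ℕ) < (k : ℕ)), t y

theorem cumSum_succ (t : Fin (n - 1) → ℝ) (k : Fin n) (h : (k : ℕ) + 1 < n) :
    cumSum t ⟨k + 1, h⟩ = cumSum t k + t ⟨k, Nat.lt_sub_of_add_lt h⟩ := by
  classical
  unfold cumSum
  have : (Finset.univ.filter fun y : Fin (n - 1) => (y : ℕ) < k + 1) =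
      insert ⟨k, Nat.lt_sub_of_add_lt h⟩ (Finset.univ.filter fun y : Fin (n - 1) => (y : ℕ) < k) := by
    ext y; simp [Fin.ext_iff]; omega
  rw [this, Finset.sum_insert (by simp), add_comm]

theorem monotone_fin_iff (φ : Fin n → ℝ) :
    Monotone φ ↔ ∀ (k : Fin n) (h : (k : ℕ) + 1 < n), φ k ≤ φ ⟨k + 1, h⟩ := by
  refine ⟨fun hφ k h => hφ (Fin.le_def.2 (Nat.le_succ _)), fun h => ?_⟩
  cases n with
  | zero => exact fun i => i.elim0
  | succ n => exact Fin.monotone_iff_le_succ.2 fun i => h i.castSucc (by simp)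

/-- The one-sided constraints that make up a bounded derivative property. -/
def BoundingFamily.offset (B : BoundingFamily n d) (r : Fin d) : Bool → Fin n → ℝ
  | true => cumSum (B.lower r)
  | false => -cumSum (B.upper r)

/-- The increments of the sum are lower bound minus upper bound. This makes the two constraints of
one dimension compatible under repair. -/
theorem BoundingFamily.antitone_offset (B : BoundingFamily n d) (r : Fin d) :
    Antitone (B.offset r true + B.offset r false) := by
  have : Monotone (-(B.offset r true + B.offset r false)) := by
    refine (monotone_fin_iff _).2 fun k h => ?_
    simp only [Pi.neg_apply, Pi.add_apply, BoundingFamily.offset, cumSum_succ]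
    have := B.lower_lt_upper r ⟨k, Nat.lt_sub_of_add_lt h⟩
    linarith
  exact fun i j hij => neg_le_neg_iff.1 (this hij)

theorem BoundingFamily.mem_property_iff (B : BoundingFamily n d) (f : Grid n d → ℝ) :
    f ∈ B.property ↔ ∀ r s, Sat B.offset r s f := by
  constructor
  · intro hf r s x
    refine (monotone_fin_iff _).2 fun k h => ?_
    have := hf r (Function.update x r k) (by simpa using h)
    simp only [Grid.succ, Function.update_self, Function.update_idem] at this
    cases s <;> simp only [lineFun, sgn, BoundingFamily.offset, Pi.neg_apply, cumSum_succ] <;>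
      simp <;> linarith
  · intro hf r x h
    have h1 := (monotone_fin_iff _).1 (hf r true x) (x r) h
    have h2 := (monotone_fin_iff _).1 (hf r false x) (x r) h
    simp only [lineFun, sgn, BoundingFamily.offset, Pi.neg_apply, cumSum_succ,
      Function.update_eq_self] at h1 h2
    simp at h1 h2
    exact ⟨by simp only [Grid.succ]; linarith, by simp only [Grid.succ]; linarith⟩

end

/-! ### Binary search through weighted medians -/

section Search
variable {α : Type*} [LinearOrder α]

/-- Take the largest `z` with at most half of the weight below it. The next element of `S` violates
this, so less than half of the weight lies above `z`. -/
theorem exists_weighted_median (v : α → ℝ) (hv : ∀ a, 0 ≤ v a) {S : Finset α}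
    (hS : S.Nonempty) : ∃ z ∈ S, 2 * ∑ x ∈ S.filter (· < z), v x ≤ ∑ x ∈ S, v x ∧
      2 * ∑ x ∈ S.filter (z < ·), v x ≤ ∑ x ∈ S, v x := by
  let Z := S.filter fun z => 2 * ∑ x ∈ S.filter (· < z), v x ≤ ∑ x ∈ S, v x
  have hZ : Z.Nonempty := by
    refine ⟨S.min' hS, Finset.mem_filter.2 ⟨S.min'_mem hS, ?_⟩⟩
    rw [Finset.filter_false_of_mem fun x hx => not_lt.2 (S.min'_le x hx)]
    simpa using Finset.sum_nonneg fun x _ => hv x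
  have hz := Finset.mem_filter.1 (Z.max'_mem hZ)
  refine ⟨Z.max' hZ, hz.1, hz.2, ?_⟩
  rcases (S.filter (Z.max' hZ < ·)).eq_empty_or_nonempty with h | h
  · rw [h]; simpa using Finset.sum_nonneg fun x _ => hv x
  · set U := S.filter (Z.max' hZ < ·)
    have hu := Finset.mem_filter.1 (U.min'_mem h)
    have hnot : U.min' h ∉ Z := fun hmem => not_lt.2 (Z.le_max' _ hmem) hu.2
    have hlt : ∑ x ∈ S, v x < 2 * ∑ x ∈ S.filter (· < U.min' h), v x := by
      by_contra hcon
      exact hnot (Finset.mem_filter.2 ⟨hu.1, not_lt.1 hcon⟩)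
    have hsplit := Finset.sum_filter_add_sum_filter_not S (· < U.min' h) v
    have hsub : ∑ x ∈ U, v x ≤ ∑ x ∈ S.filter (¬ · < U.min' h), v x :=
      Finset.sum_le_sum_of_subset_of_nonneg
        (fun x hx => Finset.mem_filter.2 ⟨(Finset.mem_filter.1 hx).1, not_lt.2 (U.min'_le x hx)⟩)
        fun x _ _ => hv x
    linarith

variable [Nonempty α]

/-- A weighted median of a finite set. -/
noncomputable def median (v : α → ℝ) (S : Finset α) : α :=
  Classical.epsilon fun z => z ∈ S ∧ 2 * ∑ x ∈ S.filter (· < z), v x ≤ ∑ x ∈ S, v x ∧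
      2 * ∑ x ∈ S.filter (z < ·), v x ≤ ∑ x ∈ S, v x

theorem median_spec {v : α → ℝ} (hv : ∀ a, 0 ≤ v a) {S : Finset α} (hS : S.Nonempty) :
    median v S ∈ S ∧ 2 * ∑ x ∈ S.filter (· < median v S), v x ≤ ∑ x ∈ S, v x ∧
      2 * ∑ x ∈ S.filter (median v S < ·), v x ≤ ∑ x ∈ S, v x :=
  Classical.epsilon_spec (p := fun z => z ∈ S ∧ 2 * ∑ x ∈ S.filter (· < z), v x ≤ ∑ x ∈ S, v x ∧
      2 * ∑ x ∈ S.filter (z < ·), v x ≤ ∑ x ∈ S, v x) (exists_weighted_median v hv hS)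

/-- The value at `x` forced by a binary search in `S` for the transition of `h`, querying
weighted medians. The first argument bounds the number of steps. -/
noncomputable def searchVal (v : α → ℝ) (h : α → Bool) : ℕ → Finset α → α → Bool
  -- Irrelevant default: with at least `S.card` steps allowed, no point of `S` gets here.
  | 0, _, _ => false
  | k + 1, S, x =>
    if h (median v S) then
      if median v S ≤ x then true else searchVal v h k (S.filter (· < median v S)) x
    else
      if x ≤ median v S then false else searchVal v h k (S.filter (median v S < ·)) x

/-- The number of queries of the binary search until the value at `x` is forced. -/
noncomputable def searchDepth (v : α → ℝ) (h : α → Bool) : ℕ → Finset α → α → ℕ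
  | 0, _, _ => 0
  | k + 1, S, x =>
    if x ∈ S then
      1 + if h (median v S) then searchDepth v h k (S.filter (· < median v S)) x
        else searchDepth v h k (S.filter (median v S < ·)) x
    else 0

variable {v : α → ℝ} {h : α → Bool}

theorem card_filter_lt_median (hv : ∀ a, 0 ≤ v a) {S : Finset α} {k : ℕ} (hS : S.Nonempty)
    (hk : S.card ≤ k + 1) : (S.filter (· < median v S)).card ≤ k :=
  Nat.lt_succ_iff.1 (lt_of_lt_of_le (Finset.card_lt_card (Finset.filter_ssubset.2
    ⟨_, (median_spec hv hS).1, lt_irrefl _⟩)) hk)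

theorem card_filter_median_lt (hv : ∀ a, 0 ≤ v a) {S : Finset α} {k : ℕ} (hS : S.Nonempty)
    (hk : S.card ≤ k + 1) : (S.filter (median v S < ·)).card ≤ k :=
  Nat.lt_succ_iff.1 (lt_of_lt_of_le (Finset.card_lt_card (Finset.filter_ssubset.2
    ⟨_, (median_spec hv hS).1, lt_irrefl _⟩)) hk)

/-- Monotonicity of `h` is not needed: points share the same queries until a median separates them,
and then the upper one gets `true` or the lower one `false`. -/
theorem searchVal_mono (hv : ∀ a, 0 ≤ v a) (k : ℕ) : ∀ (S : Finset α), S.card ≤ k →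
    ∀ x ∈ S, ∀ y ∈ S, x ≤ y → searchVal v h k S x ≤ searchVal v h k S y := by
  induction k with
  | zero => intro S hS x hx; simp_all
  | succ k ih =>
    intro S hS x hx y hy hxy
    have hne : S.Nonempty := ⟨x, hx⟩
    simp only [searchVal]
    split_ifs with h1 h2 h3 h3 h4 h5 h5
    · exact le_rfl
    · exact absurd (h2.trans hxy) h3
    · exact Bool.le_true _
    · exact ih _ (card_filter_lt_median hv hne hS) x
        (Finset.mem_filter.2 ⟨hx, not_le.1 h2⟩) y (Finset.mem_filter.2 ⟨hy, not_le.1 h3⟩) hxy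
    · exact le_rfl
    · exact Bool.false_le _
    · exact absurd (hxy.trans h5) h4
    · exact ih _ (card_filter_median_lt hv hne hS) x
        (Finset.mem_filter.2 ⟨hx, not_le.1 h4⟩) y (Finset.mem_filter.2 ⟨hy, not_le.1 h5⟩) hxy

theorem searchVal_eq (hv : ∀ a, 0 ≤ v a) (hh : Monotone h) (k : ℕ) : ∀ (S : Finset α),
    S.card ≤ k → ∀ x ∈ S, searchVal v h k S x = h x := by
  induction k with
  | zero => intro S hS x hx; simp_all
  | succ k ih =>
    intro S hS x hx
    have hne : S.Nonempty := ⟨x, hx⟩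
    simp only [searchVal]
    split_ifs with h1 h2 h3
    · exact (Bool.eq_true_of_true_le (h1 ▸ hh h2)).symm
    · exact ih _ (card_filter_lt_median hv hne hS) x (Finset.mem_filter.2 ⟨hx, not_le.1 h2⟩)
    · exact (Bool.eq_false_of_le_false ((Bool.eq_false_of_not_eq_true h1) ▸ hh h3)).symm
    · exact ih _ (card_filter_median_lt hv hne hS) x (Finset.mem_filter.2 ⟨hx, not_le.1 h3⟩)

theorem searchDepth_of_notMem (k : ℕ) {S : Finset α} {x : α} (hx : x ∉ S) :
    searchDepth v h k S x = 0 := by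
  cases k <;> simp [searchDepth, hx]

/-- The expected number of queries of the binary search for a random point is at most `2`. -/
theorem sum_searchDepth_le (hv : ∀ a, 0 ≤ v a) (k : ℕ) : ∀ (S : Finset α), S.card ≤ k →
    ∑ x ∈ S, v x * (searchDepth v h k S x : ℝ) ≤ 2 * ∑ x ∈ S, v x := by
  induction k with
  | zero => intro S hS; simp_all
  | succ k ih =>
    intro S hS
    rcases S.eq_empty_or_nonempty with rfl | hne
    · simp
    -- Either answer leaves a set `T` with at most half of the weight `W`, and the bound closes by
    -- `W + 2 * (W / 2) = 2 * W`.
    obtain ⟨T, hTS, hT, hTk, hd⟩ : ∃ T, T ⊆ S ∧ 2 * ∑ x ∈ T, v x ≤ ∑ x ∈ S, v x ∧ T.card ≤ k ∧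
        ∀ x ∈ S, searchDepth v h (k + 1) S x = 1 + searchDepth v h k T x := by
      cases hz : h (median v S) with
      | true =>
        exact ⟨_, Finset.filter_subset _ _, (median_spec hv hne).2.1,
          card_filter_lt_median hv hne hS, fun x hx => by simp [searchDepth, hx, hz]⟩
      | false =>
        exact ⟨_, Finset.filter_subset _ _, (median_spec hv hne).2.2,
          card_filter_median_lt hv hne hS, fun x hx => by simp [searchDepth, hx, hz]⟩
    have h1 : ∑ x ∈ S, v x * (searchDepth v h (k + 1) S x : ℝ) =
        ∑ x ∈ S, v x + ∑ x ∈ T, v x * (searchDepth v h k T x : ℝ) := by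
      rw [Finset.sum_subset hTS fun x _ hx => by rw [searchDepth_of_notMem k hx]; simp,
        ← Finset.sum_add_distrib]
      refine Finset.sum_congr rfl fun x hx => ?_
      rw [hd x hx]; push_cast; ring
    have := ih T hTk
    linarith

end Search

/-! ### Decomposition into thresholds -/

section Thresholds
variable {α : Type*} [LinearOrder α] [Fintype α] [Nonempty α]

/-- The points where the threshold number `i` is not decided by the a priori bounds. -/
def active (β : α → ℤ) (M : ℕ) (i : ℤ) : Finset α :=
  Finset.univ.filter fun x => β x < i ∧ i ≤ β x + M

/-- A monotone guess at whether the function reaches the threshold number `i` at `x`. -/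
noncomputable def guess (v : α → ℝ) (β : α → ℤ) (M : ℕ) (h : ℤ → α → Bool) (i : ℤ) (x : α) :
    Bool :=
  if i ≤ β x then true else if β x + M < i then false
  else searchVal v (h i) (Fintype.card α) (active β M i) x

variable {v : α → ℝ} {β : α → ℤ} {M : ℕ} {h : ℤ → α → Bool}

/-- As `β` is monotone, the points certainly above the threshold form an upper set and those
certainly below it a lower set; between them `searchVal_mono` applies. -/
theorem guess_monotone (hv : ∀ a, 0 ≤ v a) (hβ : Monotone β) (i : ℤ) :
    Monotone (guess v β M h i) := by
  intro x y hxy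
  have := hβ hxy
  unfold guess
  split_ifs with h1 h2 h3 h4 h5 h6 h7 h8
  all_goals first
    | exact le_rfl
    | exact Bool.le_true _
    | exact Bool.false_le _
    | (exfalso; omega)
    | skip
  exact searchVal_mono hv _ _ (Finset.card_le_univ _) x
    (Finset.mem_filter.2 ⟨Finset.mem_univ _, by omega, by omega⟩) y
    (Finset.mem_filter.2 ⟨Finset.mem_univ _, by omega, by omega⟩) hxy

theorem sum_Ioc_indicator_le (β q : ℤ) (h0 : β ≤ q) (hM : q ≤ β + M) :
    ∑ i ∈ Finset.Ioc β (β + M), (if i ≤ q then (1 : ℝ) else 0) = q - β := by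
  rw [Finset.sum_ite, Finset.sum_const_zero, add_zero, Finset.sum_const, nsmul_eq_mul, mul_one]
  have : (Finset.Ioc β (β + M)).filter (· ≤ q) = Finset.Ioc β q := by
    ext i; simp only [Finset.mem_filter, Finset.mem_Ioc]; omega
  rw [this, Int.card_Ioc]
  have : ((q - β).toNat : ℤ) = q - β := Int.toNat_of_nonneg (by omega)
  exact_mod_cast this

/-- Rounding and gluing the guesses for all thresholds gives a monotone function, close to `ψ` if
the guesses are mostly right. -/
theorem exists_monotone_abs_sub_le (hv : ∀ a, 0 ≤ v a) {ψ ρ : α → ℝ} {R η : ℝ} (hη : 0 < η)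
    (hM : 2 * R = η * M) (hρ : Monotone ρ) (hψ : ∀ x, |ψ x - ρ x| ≤ R)
    (hβ : ∀ x, β x = ⌊(ρ x - R) / η⌋) (hh : ∀ i x, h i x = true ↔ η * i ≤ ψ x) :
    ∃ g : α → ℝ, Monotone g ∧ ∀ x, |ψ x - g x| ≤ η + η *
      ∑ i ∈ Finset.Ioc (β x) (β x + M), if h i x = guess v β M h i x then 0 else 1 := by
  have hβm : Monotone β := by
    intro x y hxy
    rw [hβ, hβ]
    exact Int.floor_mono (div_le_div_of_nonneg_right (sub_le_sub_right (hρ hxy) _) hη.le)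
  obtain ⟨i0, hi0⟩ : ∃ i0, ∀ x, i0 ≤ β x :=
    ⟨Finset.univ.inf' Finset.univ_nonempty β, fun x => Finset.inf'_le _ (Finset.mem_univ x)⟩
  obtain ⟨i1, hi1⟩ : ∃ i1, ∀ x, β x ≤ i1 :=
    ⟨Finset.univ.sup' Finset.univ_nonempty β, fun x => Finset.le_sup' _ (Finset.mem_univ x)⟩
  -- Layer-cake sum of the guesses. One range of thresholds serves all points, so monotonicity is
  -- inherited termwise; outside the window of `x` the guesses are constant.
  refine ⟨fun x => η * (i0 + ∑ i ∈ Finset.Ioc i0 (i1 + M),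
    if guess v β M h i x = true then (1 : ℝ) else 0), ?_, fun x => ?_⟩
  · intro x y hxy
    refine mul_le_mul_of_nonneg_left (add_le_add_right (Finset.sum_le_sum fun i _ => ?_) _) hη.le
    have := guess_monotone (h := h) (M := M) hv hβm i hxy
    split_ifs with h1 h2
    · exact le_rfl
    · rw [h1] at this; exact absurd (Bool.eq_true_of_true_le this) h2
    · exact zero_le_one
    · exact le_rfl
  · have hsum : i0 + ∑ i ∈ Finset.Ioc i0 (i1 + M), (if guess v β M h i x = true then (1 : ℝ) else 0)
        = β x + ∑ i ∈ Finset.Ioc (β x) (β x + M),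
          if guess v β M h i x = true then (1 : ℝ) else 0 := by
      have e1 := hi0 x
      have e2 := hi1 x
      have hsplit : Finset.Ioc i0 (i1 + M) = (Finset.Ioc i0 (β x) ∪ Finset.Ioc (β x) (β x + M)) ∪
          Finset.Ioc (β x + M) (i1 + M) := by
        ext i; simp only [Finset.mem_union, Finset.mem_Ioc]; omega
      have hd1 : Disjoint (Finset.Ioc i0 (β x)) (Finset.Ioc (β x) (β x + M)) := by
        rw [Finset.disjoint_left]; intro i; simp only [Finset.mem_Ioc]; omega
      have hd2 : Disjoint (Finset.Ioc i0 (β x) ∪ Finset.Ioc (β x) (β x + M))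
          (Finset.Ioc (β x + M) (i1 + M)) := by
        rw [Finset.disjoint_left]; intro i; simp only [Finset.mem_union, Finset.mem_Ioc]; omega
      rw [hsplit, Finset.sum_union hd2, Finset.sum_union hd1]
      have s1 : ∑ i ∈ Finset.Ioc i0 (β x), (if guess v β M h i x = true then (1 : ℝ) else 0) =
          β x - i0 := by
        have h1 : ∀ i ∈ Finset.Ioc i0 (β x),
            (if guess v β M h i x = true then (1 : ℝ) else 0) = 1 := by
          intro i hi
          simp [guess, (Finset.mem_Ioc.1 hi).2]
        rw [Finset.sum_congr rfl h1, Finset.sum_const, Int.card_Ioc, nsmul_eq_mul, mul_one]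
        have : ((β x - i0).toNat : ℤ) = β x - i0 := Int.toNat_of_nonneg (by omega)
        exact_mod_cast this
      have s3 : ∑ i ∈ Finset.Ioc (β x + M) (i1 + M),
          (if guess v β M h i x = true then (1 : ℝ) else 0) = 0 := by
        refine Finset.sum_eq_zero fun i hi => ?_
        have := (Finset.mem_Ioc.1 hi).1
        have h1 : ¬ i ≤ β x := by omega
        simp [guess, h1, this]
      rw [s1, s3]; ring
    have hb := abs_sub_le_iff.1 (hψ x)
    have q0 : β x ≤ ⌊ψ x / η⌋ := by
      rw [hβ]
      exact Int.floor_mono (div_le_div_of_nonneg_right (by linarith) hη.le)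
    -- The window is long enough because `ψ x ≤ ρ x + R = (ρ x - R) + η * M`.
    have q1 : ⌊ψ x / η⌋ ≤ β x + M := by
      rw [hβ, ← Int.floor_add_natCast]
      refine Int.floor_mono ?_
      rw [div_add' _ _ _ hη.ne']
      exact div_le_div_of_nonneg_right (by linarith) hη.le
    have hq := sum_Ioc_indicator_le (β x) ⌊ψ x / η⌋ q0 q1
    have hround : |ψ x - η * ⌊ψ x / η⌋| ≤ η := by
      have h1 := Int.floor_le (ψ x / η)
      have h2 := Int.lt_floor_add_one (ψ x / η)
      rw [le_div_iff₀ hη] at h1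
      rw [div_lt_iff₀ hη] at h2
      exact abs_sub_le_iff.2 ⟨by linarith, by linarith⟩
    have hdiff : |(⌊ψ x / η⌋ : ℝ) - (β x + ∑ i ∈ Finset.Ioc (β x) (β x + M),
          if guess v β M h i x = true then (1 : ℝ) else 0)| ≤
        ∑ i ∈ Finset.Ioc (β x) (β x + M), if h i x = guess v β M h i x then 0 else 1 := by
      rw [← sub_sub, ← hq, ← Finset.sum_sub_distrib]
      refine (Finset.abs_sum_le_sum_abs _ _).trans (Finset.sum_le_sum fun i _ => ?_)
      have hi : i ≤ ⌊ψ x / η⌋ ↔ h i x = true := by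
        rw [hh, Int.le_floor, le_div_iff₀ hη, mul_comm]
      simp only [hi]
      cases h i x <;> cases guess v β M h i x <;> simp
    dsimp only
    rw [hsum]
    refine (abs_sub_le _ (η * ⌊ψ x / η⌋) _).trans (add_le_add hround ?_)
    rw [← mul_sub, abs_mul, abs_of_pos hη]
    exact mul_le_mul_of_nonneg_left hdiff hη.le

theorem guess_eq (hv : ∀ a, 0 ≤ v a) {i : ℤ} (hh : Monotone (h i)) {x : α}
    (hi : i ∈ Finset.Ioc (β x) (β x + M)) : guess v β M h i x = h i x := by
  rw [Finset.mem_Ioc] at hi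
  rw [guess, if_neg (by omega), if_neg (by omega)]
  exact searchVal_eq hv hh _ _ (Finset.card_le_univ _) x
    (Finset.mem_filter.2 ⟨Finset.mem_univ _, hi⟩)

/-- The binary searches for a random threshold and a random point take two queries on average. -/
theorem sum_sum_searchDepth_le (hv : ∀ a, 0 ≤ v a) :
    ∑ x, v x * ∑ i ∈ Finset.Ioc (β x) (β x + M),
      (searchDepth v (h i) (Fintype.card α) (active β M i) x : ℝ) ≤ 2 * M * ∑ x, v x := by
  classical
  obtain ⟨I, hI⟩ : ∃ I : Finset ℤ, ∀ x, Finset.Ioc (β x) (β x + M) ⊆ I :=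
    ⟨Finset.univ.biUnion fun x => Finset.Ioc (β x) (β x + M), fun x =>
      Finset.subset_biUnion_of_mem (fun x => Finset.Ioc (β x) (β x + M)) (Finset.mem_univ x)⟩
  -- For a fixed threshold, the points having it in their window are exactly the set of one binary
  -- search.
  have swap : ∀ F : ℤ → α → ℝ, ∑ x, ∑ i ∈ Finset.Ioc (β x) (β x + M), F i x =
      ∑ i ∈ I, ∑ x ∈ active β M i, F i x := by
    intro F
    refine Finset.sum_comm' fun x i => ?_
    simp only [active, Finset.mem_univ, true_and, Finset.mem_filter, Finset.mem_Ioc]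
    exact ⟨fun hi => ⟨hi, hI x (Finset.mem_Ioc.2 hi)⟩, fun hi => hi.1⟩
  simp only [Finset.mul_sum]
  rw [swap]
  calc _ ≤ ∑ i ∈ I, ∑ x ∈ active β M i, 2 * v x := by
        refine Finset.sum_le_sum fun i _ => ?_
        rw [← Finset.mul_sum]
        exact sum_searchDepth_le hv _ _ (Finset.card_le_univ _)
    _ = _ := by
        rw [← swap fun _ x => 2 * v x]
        refine Finset.sum_congr rfl fun x _ => ?_
        rw [Finset.sum_const, Int.card_Ioc, add_sub_cancel_left, Int.toNat_natCast, nsmul_eq_mul]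
        ring

theorem sum_fin_eq_sum_Ioc (β : ℤ) (F : ℤ → ℝ) :
    ∑ s : Fin M, F (β + 1 + s) = ∑ i ∈ Finset.Ioc β (β + M), F i := by
  refine Finset.sum_nbij (fun s : Fin M => β + 1 + (s : ℕ)) ?_ ?_ ?_ fun _ _ => rfl
  · intro s _
    have := s.2
    simp only [Finset.mem_Ioc]; omega
  · intro s _ t _ hst
    simp only at hst
    exact Fin.ext (by omega)
  · intro i hi
    simp only [Finset.coe_Ioc, Set.mem_Ioc] at hi
    exact ⟨⟨(i - β - 1).toNat, by omega⟩, by simp, by simp only; omega⟩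

end Thresholds

/-! ### Truncated algorithms and their verdicts -/

/-- The algorithm cut off after `k` instructions, accepting there. -/
noncomputable def Algo.trunc {X : Type} : Algo X → ℕ → Algo X
  | .accept, _ => .accept
  | .reject, _ => .reject
  | .query _ _ _, 0 => .accept
  | .query x i next, k + 1 => .query x i (next.trunc k)
  | .const _ _ _, 0 => .accept
  | .const c i next, k + 1 => .const c i (next.trunc k)
  | .arith _ _ _ _ _, 0 => .accept
  | .arith op i j l next, k + 1 => .arith op i j l (next.trunc k)
  | .branch _ _ _ _, 0 => .accept
  | .branch i j le gt, k + 1 => .branch i j (le.trunc k) (gt.trunc k)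
  | .coin _ _ _, 0 => .accept
  | .coin i heads tails, k + 1 => .coin i (heads.trunc k) (tails.trunc k)
  | .sample _ _, 0 => .accept
  | .sample ν next, k + 1 => .sample ν fun o => (next o).trunc k

theorem Algo.time_trunc_le {X : Type} (A : Algo X) : ∀ k, (A.trunc k).time ≤ k := by
  induction A with
  | accept => intro k; simp [Algo.trunc, Algo.time]
  | reject => intro k; simp [Algo.trunc, Algo.time]
  | query x i next ih => intro k; cases k <;> simp [Algo.trunc, Algo.time, ih]
  | const x i next ih => intro k; cases k <;> simp [Algo.trunc, Algo.time, ih]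
  | arith op i j l next ih => intro k; cases k <;> simp [Algo.trunc, Algo.time, ih]
  | branch i j le gt ih1 ih2 => intro k; cases k <;> simp [Algo.trunc, Algo.time, ih1, ih2]
  | coin i heads tails ih1 ih2 => intro k; cases k <;> simp [Algo.trunc, Algo.time, ih1, ih2]
  | sample ν next ih => intro k; cases k <;> simp [Algo.trunc, Algo.time, ih]

/-- With the oracle `f`, the algorithm gives the verdict `b` within `k` instructions, whatever the
registers contain initially. -/
def Algo.Outcome {X : Type} (f : X → ℝ) (A : Algo X) (b : Bool) (k : ℕ) : Prop :=
  -- A cut-off accepts, so an accepting run survives any truncation, while a rejecting one needs its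
  -- full `k` instructions.
  ∀ (s : ℕ → ℝ) (τ : ℕ), k ≤ τ ∨ b = true → (A.trunc τ).run f s = PMF.pure b

section Outcome
variable {X : Type} {f : X → ℝ}

theorem Algo.outcome_accept : Algo.Outcome f .accept true 0 := fun _ _ _ => rfl

theorem Algo.outcome_reject : Algo.Outcome f .reject false 0 := fun _ _ _ => rfl

theorem Algo.Outcome.mono {A : Algo X} {b : Bool} {k k' : ℕ} (h : A.Outcome f b k)
    (hk : k ≤ k') : A.Outcome f b k' :=
  fun s τ hτ => h s τ (hτ.imp_left hk.trans)

/-- Compare `t` to `f z`, up to the sign `s`. -/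
noncomputable def compareAlgo (z : X) (s : Bool) (t : ℝ) (yes no : Algo X) : Algo X :=
  .query z 0 (.const (sgn s * t) 1
    -- For the negative sign, `t ≤ -f z` is tested as `f z ≤ -t`, hence the exchanged registers.
    (if s then .branch 1 0 yes no else .branch 0 1 yes no))

theorem outcome_compareAlgo {z : X} {s : Bool} {t : ℝ} {yes no : Algo X} {b : Bool} {k : ℕ}
    (hyes : t ≤ sgn s * f z → yes.Outcome f b k) (hno : ¬ t ≤ sgn s * f z → no.Outcome f b k) :
    (compareAlgo z s t yes no).Outcome f b (k + 3) := by
  intro st τ hτ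
  -- Cut off before the three instructions are done, the run accepts; this concerns only `b = true`.
  rcases τ with _ | _ | _ | τ
  · rcases hτ with h | rfl
    · omega
    · rfl
  · rcases hτ with h | rfl
    · omega
    · rfl
  · rcases hτ with h | rfl
    · omega
    · cases s <;> rfl
  · have hτ' : k ≤ τ ∨ b = true := hτ.imp_left fun h => by omega
    cases s with
    | true =>
      simp only [sgn, if_true, one_mul] at hyes hno
      simp only [compareAlgo, sgn, if_true, one_mul, Algo.trunc, Algo.run]
      simp only [Function.update_self, ne_eq, zero_ne_one, not_false_eq_true,
        Function.update_of_ne]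
      split_ifs with h
      · exact hyes h _ τ hτ'
      · exact hno h _ τ hτ'
    | false =>
      simp only [sgn, Bool.false_eq_true, if_false, neg_mul, one_mul] at hyes hno
      simp only [compareAlgo, sgn, Bool.false_eq_true, if_false, neg_mul, one_mul, Algo.trunc,
        Algo.run]
      simp only [Function.update_self, ne_eq, zero_ne_one, not_false_eq_true,
        Function.update_of_ne]
      split_ifs with h
      · exact hyes (by linarith) _ τ hτ'
      · exact hno (by intro h'; exact h (by linarith)) _ τ hτ'

section
variable {α : Type*} [LinearOrder α] [Nonempty α]

/-- The binary search as an algorithm that checks the known value `b` at `x`, where `cmp`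
compares at a point. -/
noncomputable def searchAlgo (v : α → ℝ) (cmp : α → Algo X → Algo X → Algo X) (x : α) (b : Bool)
    (next : Algo X) : ℕ → Finset α → Algo X
  | 0, _ => next
  | k + 1, S =>
    cmp (median v S)
      (if median v S ≤ x then (if b then next else .reject)
        else searchAlgo v cmp x b next k (S.filter (· < median v S)))
      (if x ≤ median v S then (if b then .reject else next)
        else searchAlgo v cmp x b next k (S.filter (median v S < ·)))

/-- The recursion parallels `searchVal` and `searchDepth`, at three instructions per query; an early
rejection only makes the cost bound generous. -/
theorem outcome_searchAlgo {v : α → ℝ} (hv : ∀ a, 0 ≤ v a)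
    {cmp : α → Algo X → Algo X → Algo X} {h : α → Bool}
    (hcmp : ∀ z yes no b k, (h z = true → yes.Outcome f b k) → (h z = false → no.Outcome f b k) →
      (cmp z yes no).Outcome f b (k + 3))
    {x : α} {b b' : Bool} {next : Algo X} {K : ℕ} (hnext : next.Outcome f b' K) (k : ℕ) :
    ∀ S : Finset α, S.card ≤ k → x ∈ S → (searchAlgo v cmp x b next k S).Outcome f
      ((b == searchVal v h k S x) && b') (K + 3 * searchDepth v h k S x) := by
  induction k with
  | zero => intro S hS hx; simp_all
  | succ k ih =>
    intro S hS hx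
    have hne : S.Nonempty := ⟨x, hx⟩
    have hd : searchDepth v h (k + 1) S x = 1 + if h (median v S) = true then
        searchDepth v h k (S.filter (· < median v S)) x
        else searchDepth v h k (S.filter (median v S < ·)) x := by
      rw [searchDepth, if_pos hx]
    rw [hd, mul_add, mul_one, add_comm 3, ← add_assoc, searchAlgo]
    have hrej : ∀ k, Algo.Outcome f (.reject : Algo X) false k := fun k =>
      Algo.outcome_reject.mono (Nat.zero_le k)
    refine hcmp _ _ _ _ _ (fun h1 => ?_) (fun h1 => ?_)
    · simp only [searchVal, h1, if_true]
      split_ifs with h2 h3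
      · simpa [h3] using hnext.mono (Nat.le_add_right _ _)
      · simpa [h3] using hrej _
      · exact ih _ (card_filter_lt_median hv hne hS) (Finset.mem_filter.2 ⟨hx, not_le.1 h2⟩)
    · simp only [searchVal, h1, Bool.false_eq_true, if_false]
      split_ifs with h2 h3
      · simpa [h3] using hrej _
      · simpa [h3] using hnext.mono (Nat.le_add_right _ _)
      · exact ih _ (card_filter_median_lt hv hne hS) (Finset.mem_filter.2 ⟨hx, not_le.1 h2⟩)

end

end Outcome

/-! ### A single trial -/

/-- The data that the tester is built from: weights of the coordinates, the one-sided
constraints, a function with these constraints, a bound for the distance from it, and the step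
and number of the thresholds. -/
structure TesterData (n d : ℕ) where
  w : Fin d → Fin n → ℝ
  c : Fin d → Bool → Fin n → ℝ
  m : Grid n d → ℝ
  R : ℝ
  η : ℝ
  M : ℕ

/-- The random choices of a trial: a one-sided constraint, a point and a threshold. -/
abbrev TesterData.Trial {n d : ℕ} (P : TesterData n d) : Type :=
  (Fin d × Bool) × Grid n d × Fin P.M

namespace TesterData
variable {n d : ℕ} (P : TesterData n d)

/-- The last threshold that is certainly reached. -/
noncomputable def base (r : Fin d) (s : Bool) (x : Grid n d) (k : Fin n) : ℤ :=
  ⌊(lineFun P.c r s P.m x k - P.R) / P.η⌋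

/-- Whether the threshold `i` is reached at the point number `k` of the line. -/
noncomputable def hit (f : Grid n d → ℝ) (r : Fin d) (s : Bool) (x : Grid n d) (i : ℤ)
    (k : Fin n) : Bool :=
  haveI := Classical.propDecidable (P.η * i ≤ lineFun P.c r s f x k)
  decide (P.η * i ≤ lineFun P.c r s f x k)

theorem hit_iff (f : Grid n d → ℝ) (r : Fin d) (s : Bool) (x : Grid n d) (i : ℤ) (k : Fin n) :
    P.hit f r s x i k = true ↔ P.η * i ≤ lineFun P.c r s f x k := by
  simp [hit]

/-- The threshold of a trial. -/
noncomputable def level (ω : P.Trial) : ℤ :=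
  -- The shift by one skips the base threshold, which is certainly reached.
  P.base ω.1.1 ω.1.2 ω.2.1 (ω.2.1 ω.1.1) + 1 + (ω.2.2 : ℕ)

/-- The undecided points on the line of a trial. -/
noncomputable def window (ω : P.Trial) : Finset (Fin n) :=
  active (P.base ω.1.1 ω.1.2 ω.2.1) P.M (P.level ω)

theorem level_mem (ω : P.Trial) : P.level ω ∈ Finset.Ioc
    (P.base ω.1.1 ω.1.2 ω.2.1 (ω.2.1 ω.1.1)) (P.base ω.1.1 ω.1.2 ω.2.1 (ω.2.1 ω.1.1) + P.M) := by
  have := ω.2.2.2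
  simp only [Finset.mem_Ioc, level]; omega

theorem mem_window (ω : P.Trial) : ω.2.1 ω.1.1 ∈ P.window ω :=
  Finset.mem_filter.2 ⟨Finset.mem_univ _, Finset.mem_Ioc.1 (P.level_mem ω)⟩

/-- The comparison of `f` to the threshold of a trial. -/
noncomputable def compare (ω : P.Trial) (k : Fin n) (yes no : Algo (Grid n d)) :
    Algo (Grid n d) :=
  compareAlgo (Function.update ω.2.1 ω.1.1 k) ω.1.2 (P.η * P.level ω + P.c ω.1.1 ω.1.2 k) yes no

theorem outcome_compare {f : Grid n d → ℝ} (ω : P.Trial) (z : Fin n) (yes no : Algo (Grid n d))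
    (b : Bool) (k : ℕ)
    (hyes : P.hit f ω.1.1 ω.1.2 ω.2.1 (P.level ω) z = true → yes.Outcome f b k)
    (hno : P.hit f ω.1.1 ω.1.2 ω.2.1 (P.level ω) z = false → no.Outcome f b k) :
    (P.compare ω z yes no).Outcome f b (k + 3) := by
  rw [← Bool.not_eq_true, hit_iff, lineFun, le_sub_iff_add_le] at hno
  rw [hit_iff, lineFun, le_sub_iff_add_le] at hyes
  exact outcome_compareAlgo hyes hno

variable [NeZero n]

/-- A trial passes if the value at the random point is the one forced by the binary search. -/
noncomputable def pass (f : Grid n d → ℝ) (ω : P.Trial) : Bool :=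
  P.hit f ω.1.1 ω.1.2 ω.2.1 (P.level ω) (ω.2.1 ω.1.1) ==
    guess (P.w ω.1.1) (P.base ω.1.1 ω.1.2 ω.2.1) P.M (P.hit f ω.1.1 ω.1.2 ω.2.1) (P.level ω)
      (ω.2.1 ω.1.1)

/-- The number of instructions of a trial. -/
noncomputable def cost (f : Grid n d → ℝ) (ω : P.Trial) : ℕ :=
  3 * searchDepth (P.w ω.1.1) (P.hit f ω.1.1 ω.1.2 ω.2.1 (P.level ω)) (Fintype.card (Fin n))
    (P.window ω) (ω.2.1 ω.1.1) + 3

/-- One trial of the tester, followed by `next` if it passes. -/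
noncomputable def trialAlgo (ω : P.Trial) (next : Algo (Grid n d)) : Algo (Grid n d) :=
  P.compare ω (ω.2.1 ω.1.1)
    (searchAlgo (P.w ω.1.1) (P.compare ω) (ω.2.1 ω.1.1) true next (Fintype.card (Fin n))
      (P.window ω))
    (searchAlgo (P.w ω.1.1) (P.compare ω) (ω.2.1 ω.1.1) false next (Fintype.card (Fin n))
      (P.window ω))

theorem outcome_trialAlgo (hw : ∀ r k, 0 ≤ P.w r k) {f : Grid n d → ℝ} (ω : P.Trial)
    {next : Algo (Grid n d)} {b : Bool} {K : ℕ} (h : next.Outcome f b K) :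
    (P.trialAlgo ω next).Outcome f (P.pass f ω && b) (P.cost f ω + K) := by
  have key := fun b' => outcome_searchAlgo (b := b') (hw ω.1.1) (P.outcome_compare (f := f) ω) h
    (Fintype.card (Fin n)) (P.window ω) (Finset.card_le_univ _) (P.mem_window ω)
  have hg : guess (P.w ω.1.1) (P.base ω.1.1 ω.1.2 ω.2.1) P.M (P.hit f ω.1.1 ω.1.2 ω.2.1)
      (P.level ω) (ω.2.1 ω.1.1) = searchVal (P.w ω.1.1)
      (P.hit f ω.1.1 ω.1.2 ω.2.1 (P.level ω)) (Fintype.card (Fin n)) (P.window ω)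
      (ω.2.1 ω.1.1) := by
    have := Finset.mem_Ioc.1 (P.level_mem ω)
    rw [guess, if_neg (by omega), if_neg (by omega)]
    rfl
  have hcost : P.cost f ω + K = K + 3 * searchDepth (P.w ω.1.1)
      (P.hit f ω.1.1 ω.1.2 ω.2.1 (P.level ω)) (Fintype.card (Fin n)) (P.window ω)
      (ω.2.1 ω.1.1) + 3 := by
    rw [cost]; ring
  rw [hcost, pass, hg]
  refine P.outcome_compare ω _ _ _ _ _ (fun h1 => ?_) (fun h1 => ?_)
  · rw [h1]; exact key true
  · rw [h1]; exact key false

/-- A sequence of trials. -/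
noncomputable def trialsAlgo (L : List P.Trial) : Algo (Grid n d) :=
  L.foldr P.trialAlgo .accept

theorem outcome_trialsAlgo (hw : ∀ r k, 0 ≤ P.w r k) {f : Grid n d → ℝ} (L : List P.Trial) :
    (P.trialsAlgo L).Outcome f (L.all (P.pass f)) (L.map (P.cost f)).sum := by
  induction L with
  | nil => exact Algo.outcome_accept
  | cons ω L ih => exact P.outcome_trialAlgo hw ω ih

end TesterData

/-! ### Independent repetition -/

section Repetition
variable {Ω : Type*} [Fintype Ω] {q : ℕ}

theorem sum_prod_mul_apply {wt : Ω → ℝ} (h1 : ∑ a, wt a = 1) (t : Ω → ℝ) (i : Fin q) :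
    ∑ ω : Fin q → Ω, (∏ l, wt (ω l)) * t (ω i) = ∑ a, wt a * t a := by
  classical
  have h := Finset.prod_univ_sum (fun _ : Fin q => (Finset.univ : Finset Ω))
    fun l a => wt a * if l = i then t a else 1
  rw [Fintype.piFinset_univ, Finset.prod_eq_single i (fun l _ hl => by simp [hl, h1])
    (by simp)] at h
  simp only [if_true, Finset.prod_mul_distrib, Finset.prod_ite_eq', Finset.mem_univ] at h
  exact h.symm

theorem sum_prod_eq_one {wt : Ω → ℝ} (h1 : ∑ a, wt a = 1) :
    ∑ ω : Fin q → Ω, ∏ l, wt (ω l) = 1 := by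
  rw [← Fintype.sum_pow, h1, one_pow]

/-- Among `q ≥ 5 / κ` independent trials, each with failure probability at least `κ` and expected
cost at most `9`, there is with probability at least `2 / 3` one that fails, at total cost at
most `54 q`. -/
theorem two_thirds_le_sum_prod {wt : Ω → ℝ} (h0 : ∀ a, 0 ≤ wt a) (h1 : ∑ a, wt a = 1)
    {pass : Ω → Bool} {cost : Ω → ℕ} {κ : ℝ} (hκ : κ ≤ ∑ a, wt a * if pass a then 0 else 1)
    (hcost : ∑ a, wt a * (cost a : ℝ) ≤ 9) (hq : 5 ≤ κ * q) (hq0 : 0 < q) :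
    2 / 3 ≤ ∑ ω : Fin q → Ω, (∏ l, wt (ω l)) *
      if (∃ l, pass (ω l) = false) ∧ ∑ l, cost (ω l) ≤ 54 * q then 1 else 0 := by
  classical
  have hq' : (0 : ℝ) < q := Nat.cast_pos.2 hq0
  -- All trials pass with probability at most `exp (-κ * q) ≤ exp (-5) ≤ 1 / 6`.
  have e1 : ∑ ω : Fin q → Ω, (∏ l, wt (ω l)) * (∏ l, if pass (ω l) then (1 : ℝ) else 0) ≤ 1 / 6 := by
    simp only [← Finset.prod_mul_distrib]
    rw [← Fintype.sum_pow fun a => wt a * if pass a then (1 : ℝ) else 0]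
    have hp : ∑ a, wt a * (if pass a then (1 : ℝ) else 0) ≤ Real.exp (-κ) := by
      have : ∑ a, wt a * (if pass a then (1 : ℝ) else 0) =
          1 - ∑ a, wt a * if pass a then 0 else 1 := by
        rw [eq_sub_iff_add_eq, ← Finset.sum_add_distrib]
        refine Eq.trans ?_ h1
        refine Finset.sum_congr rfl fun a _ => ?_
        split_ifs <;> simp
      have := Real.add_one_le_exp (-κ)
      linarith
    have hn : 0 ≤ ∑ a, wt a * (if pass a then (1 : ℝ) else 0) :=
      Finset.sum_nonneg fun a _ => mul_nonneg (h0 a) (by split_ifs <;> norm_num)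
    refine (pow_le_pow_left₀ hn hp q).trans ?_
    rw [← Real.exp_nat_mul, mul_neg, Real.exp_neg, inv_eq_one_div]
    refine one_div_le_one_div_of_le (by norm_num) ?_
    have := Real.add_one_le_exp ((q : ℝ) * κ)
    linarith
  -- Markov's inequality: the expected total cost `9 * q` is a sixth of `54 * q`.
  have e2 : ∑ ω : Fin q → Ω, (∏ l, wt (ω l)) * ((∑ l, (cost (ω l) : ℝ)) / (54 * q)) ≤ 1 / 6 := by
    have : ∑ ω : Fin q → Ω, (∏ l, wt (ω l)) * ((∑ l, (cost (ω l) : ℝ)) / (54 * q)) =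
        (∑ l : Fin q, ∑ ω : Fin q → Ω, (∏ l, wt (ω l)) * (cost (ω l) : ℝ)) / (54 * q) := by
      rw [Finset.sum_comm, Finset.sum_div]
      refine Finset.sum_congr rfl fun ω _ => ?_
      rw [← Finset.mul_sum, mul_div_assoc]
    rw [this, Finset.sum_congr rfl fun l _ => sum_prod_mul_apply h1 (fun a => (cost a : ℝ)) l,
      Finset.sum_const, Finset.card_univ, Fintype.card_fin, nsmul_eq_mul,
      div_le_iff₀ (by positivity)]
    nlinarith
  have e0 := sum_prod_eq_one (q := q) h1
  refine le_trans (show (2 / 3 : ℝ) ≤ ∑ ω : Fin q → Ω, (∏ l, wt (ω l)) *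
    (1 - (∏ l, if pass (ω l) then (1 : ℝ) else 0) - (∑ l, (cost (ω l) : ℝ)) / (54 * q)) from ?_)
    (Finset.sum_le_sum fun ω _ => mul_le_mul_of_nonneg_left ?_
      (Finset.prod_nonneg fun l _ => h0 _))
  · simp only [mul_sub, mul_one, Finset.sum_sub_distrib]
    linarith
  · have hc : (0 : ℝ) ≤ (∑ l, (cost (ω l) : ℝ)) / (54 * q) := by positivity
    have hp : (0 : ℝ) ≤ ∏ l, if pass (ω l) then (1 : ℝ) else 0 :=
      Finset.prod_nonneg fun l _ => by split_ifs <;> norm_num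
    split_ifs with h
    · linarith
    · rcases not_and_or.1 h with h | h
      · push Not at h
        rw [Finset.prod_eq_one fun l _ => by simp [h l]]
        linarith
      · have h' : (54 * q : ℝ) < ∑ l, (cost (ω l) : ℝ) := by exact_mod_cast not_le.1 h
        have := (one_lt_div (by positivity)).2 h'
        linarith

end Repetition

/-! ### Failure probability and expected cost of a trial -/

/-- The distribution with the given real weights. -/
noncomputable def pmfOfReal {N : ℕ} (t : Fin N → ℝ) (h0 : ∀ o, 0 ≤ t o) (h1 : ∑ o, t o = 1) :
    PMF (Fin N) :=
  PMF.ofFintype (fun o => ENNReal.ofReal (t o)) (by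
    rw [← ENNReal.ofReal_sum_of_nonneg fun o _ => h0 o, h1, ENNReal.ofReal_one])

theorem sum_le_verdict_sample {X : Type} {N : ℕ} {t : Fin N → ℝ} (h0 : ∀ o, 0 ≤ t o)
    (h1 : ∑ o, t o = 1) (next : Fin N → Algo X) (f : X → ℝ) (b : Bool) (u : Fin N → ℝ)
    (hu : ∀ o, u o ≤ ((next o).verdict f b).toReal) :
    ∑ o, t o * u o ≤ ((Algo.sample (pmfOfReal t h0 h1) next).verdict f b).toReal := by
  show _ ≤ ((PMF.bind _ _) b).toReal
  rw [PMF.bind_apply, tsum_fintype, ENNReal.toReal_sum fun o _ =>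
    ENNReal.mul_ne_top (PMF.apply_ne_top _ _) (PMF.apply_ne_top _ _)]
  refine Finset.sum_le_sum fun o _ => ?_
  rw [ENNReal.toReal_mul, pmfOfReal, PMF.ofFintype_apply, ENNReal.toReal_ofReal (h0 o)]
  exact mul_le_mul_of_nonneg_left (hu o) (h0 o)

namespace TesterData
variable {n d : ℕ} (P : TesterData n d)

/-- The probability of the random choices of a trial. -/
noncomputable def trialWeight (ω : P.Trial) : ℝ := weight P.w ω.2.1 / (2 * d * P.M)

/-- The requirements on the data of the tester. -/
structure Valid : Prop where
  dim_pos : 0 < d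
  w_pos : ∀ r k, 0 < P.w r k
  sum_w : ∀ r, ∑ k, P.w r k = 1
  antitone_c : ∀ r, Antitone (P.c r true + P.c r false)
  sat_m : ∀ r s, Sat P.c r s P.m
  η_pos : 0 < P.η
  M_pos : 0 < P.M
  two_mul_R : 2 * P.R = P.η * P.M

variable {P}

theorem Valid.trialWeight_nonneg (hP : P.Valid) (ω : P.Trial) : 0 ≤ P.trialWeight ω :=
  div_nonneg (weight_nonneg (fun r k => (hP.w_pos r k).le) _) (by positivity)

theorem sum_trialWeight_mul (F : P.Trial → ℝ) : ∑ ω, P.trialWeight ω * F ω =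
    (∑ j : Fin d × Bool, ∑ x, weight P.w x * ∑ s, F (j, x, s)) / (2 * d * P.M) := by
  rw [Fintype.sum_prod_type, Finset.sum_div]
  refine Finset.sum_congr rfl fun j _ => ?_
  rw [Fintype.sum_prod_type, Finset.sum_div]
  refine Finset.sum_congr rfl fun x _ => ?_
  rw [Finset.mul_sum, Finset.sum_div]
  refine Finset.sum_congr rfl fun s _ => ?_
  rw [trialWeight, div_mul_eq_mul_div]

theorem Valid.sum_trialWeight (hP : P.Valid) : ∑ ω, P.trialWeight ω = 1 := by
  have h := sum_trialWeight_mul (P := P) fun _ => 1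
  simp only [mul_one] at h
  have hd : (0 : ℝ) < d := Nat.cast_pos.2 hP.dim_pos
  have hM : (0 : ℝ) < P.M := Nat.cast_pos.2 hP.M_pos
  rw [h]
  simp only [Finset.sum_const, Finset.card_univ, Fintype.card_fin, Fintype.card_prod,
    Fintype.card_bool, nsmul_eq_mul, mul_one]
  rw [← Finset.sum_mul, sum_weight hP.sum_w]
  push_cast
  field_simp

theorem base_update (r : Fin d) (s : Bool) (x : Grid n d) (k : Fin n) :
    P.base r s (Function.update x r k) = P.base r s x := by
  funext j; simp only [base, lineFun_update]

theorem hit_update (f : Grid n d → ℝ) (r : Fin d) (s : Bool) (x : Grid n d) (k : Fin n) :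
    P.hit f r s (Function.update x r k) = P.hit f r s x := by
  funext i j; simp only [hit, lineFun_update]

variable [NeZero n]

/-- The number of thresholds at a point for which a trial fails. -/
noncomputable def failCount (P : TesterData n d) (f : Grid n d → ℝ) (j : Fin d × Bool)
    (x : Grid n d) : ℝ :=
  ∑ i ∈ Finset.Ioc (P.base j.1 j.2 x (x j.1)) (P.base j.1 j.2 x (x j.1) + P.M),
    if P.hit f j.1 j.2 x i (x j.1) =
      guess (P.w j.1) (P.base j.1 j.2 x) P.M (P.hit f j.1 j.2 x) i (x j.1) then 0 else 1

theorem sum_trialWeight_mul_pass (f : Grid n d → ℝ) :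
    ∑ ω, P.trialWeight ω * (if P.pass f ω then 0 else 1) =
      (∑ j : Fin d × Bool, ∑ x, weight P.w x * P.failCount f j x) / (2 * d * P.M) := by
  rw [sum_trialWeight_mul]
  congr 1
  refine Finset.sum_congr rfl fun j _ => Finset.sum_congr rfl fun x _ => ?_
  rw [failCount, ← sum_fin_eq_sum_Ioc]
  congr 1
  refine Finset.sum_congr rfl fun s _ => ?_
  simp only [pass, beq_iff_eq, level]

/-- Nine is three instructions for each of at most two expected search queries, plus three for the
query at the point itself. Resampling one coordinate reduces the expectation to a single line. -/
theorem Valid.sum_trialWeight_mul_cost_le (hP : P.Valid) (f : Grid n d → ℝ) :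
    ∑ ω, P.trialWeight ω * (P.cost f ω : ℝ) ≤ 9 := by
  have hd : (0 : ℝ) < d := Nat.cast_pos.2 hP.dim_pos
  have hM : (0 : ℝ) < P.M := Nat.cast_pos.2 hP.M_pos
  have hw : ∀ r k, 0 ≤ P.w r k := fun r k => (hP.w_pos r k).le
  let dep : Fin d × Bool → Grid n d → ℤ → Fin n → ℝ := fun j x i k =>
    (searchDepth (P.w j.1) (P.hit f j.1 j.2 x i) (Fintype.card (Fin n))
      (active (P.base j.1 j.2 x) P.M i) k : ℝ)
  have hdep : ∑ ω, P.trialWeight ω *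
      dep ω.1 ω.2.1 (P.level ω) (ω.2.1 ω.1.1) ≤ 2 := by
    rw [sum_trialWeight_mul, div_le_iff₀ (by positivity)]
    have hj : ∀ j : Fin d × Bool, ∑ x, weight P.w x *
        ∑ s, dep j x (P.level (j, x, s)) (x j.1) ≤ 2 * P.M := by
      intro j
      rw [← sum_weight_mul_resample hP.sum_w j.1, ← mul_one (2 * (P.M : ℝ)),
        ← sum_weight hP.sum_w, Finset.mul_sum]
      refine Finset.sum_le_sum fun x _ => ?_
      rw [mul_comm (2 * (P.M : ℝ))]
      refine mul_le_mul_of_nonneg_left ?_ (weight_nonneg hw x)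
      have h := sum_sum_searchDepth_le (v := P.w j.1) (β := P.base j.1 j.2 x) (M := P.M)
        (h := P.hit f j.1 j.2 x) (hw j.1)
      rw [hP.sum_w, mul_one] at h
      refine le_trans (le_of_eq (Finset.sum_congr rfl fun k _ => ?_)) h
      rw [← sum_fin_eq_sum_Ioc]
      simp only [dep, level, base_update, hit_update, Function.update_self]
    refine (Finset.sum_le_sum fun j _ => hj j).trans (le_of_eq ?_)
    simp only [Finset.sum_const, Finset.card_univ, Fintype.card_fin, Fintype.card_prod,
      Fintype.card_bool, nsmul_eq_mul]
    push_cast; ring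
  have hcost : ∀ ω : P.Trial, (P.cost f ω : ℝ) =
      3 * dep ω.1 ω.2.1 (P.level ω) (ω.2.1 ω.1.1) + 3 := by
    intro ω; simp only [cost, dep, window]; push_cast; ring
  have h1 := hP.sum_trialWeight
  calc ∑ ω, P.trialWeight ω * (P.cost f ω : ℝ)
      = 3 * ∑ ω, P.trialWeight ω * dep ω.1 ω.2.1 (P.level ω) (ω.2.1 ω.1.1) +
          3 * ∑ ω, P.trialWeight ω := by
        rw [Finset.mul_sum, Finset.mul_sum, ← Finset.sum_add_distrib]
        refine Finset.sum_congr rfl fun ω _ => ?_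
        rw [hcost]; ring
    _ ≤ 9 := by linarith

/-- If the trials rarely fail for a one-sided constraint, the function is close to it. -/
theorem Valid.exists_sat_l1Dist_le (hP : P.Valid) {f : Grid n d → ℝ}
    (hf : ∀ x, |f x - P.m x| ≤ P.R) (j : Fin d × Bool) :
    ∃ g, Sat P.c j.1 j.2 g ∧
      l1Dist P.w f g ≤ P.η + P.η * ∑ x, weight P.w x * P.failCount f j x := by
  obtain ⟨r, s⟩ := j
  have hw : ∀ r k, 0 ≤ P.w r k := fun r k => (hP.w_pos r k).le
  have hline := fun x => exists_monotone_abs_sub_le (v := P.w r) (hw r)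
    (ψ := lineFun P.c r s f x) (ρ := lineFun P.c r s P.m x) (h := P.hit f r s x)
    (β := P.base r s x) hP.η_pos hP.two_mul_R
    (hP.sat_m r s x) (fun k => by
      rw [lineFun, lineFun, sub_sub_sub_cancel_right, ← mul_sub, abs_mul, abs_sgn, one_mul]
      exact hf _) (fun _ => rfl) (P.hit_iff f r s x)
  choose G hG1 hG2 using hline
  -- A representative of the line through `x`, so that all points of the line use the same `G`.
  let rep : Grid n d → Grid n d := fun x => Function.update x r 0
  have hrep : ∀ x k, rep (Function.update x r k) = rep x := fun x k => by
    simp [rep]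
  refine ⟨fun x => sgn s * (G (rep x) (x r) + P.c r s (x r)), fun x => ?_, ?_⟩
  · have : lineFun P.c r s (fun x => sgn s * (G (rep x) (x r) + P.c r s (x r))) x =
        G (rep x) := by
      funext k
      simp only [lineFun, hrep, Function.update_self]
      rw [sgn_mul_sgn_mul, add_sub_cancel_right]
    rw [this]
    exact hG1 _
  · calc l1Dist P.w f _ ≤ ∑ x, weight P.w x * (P.η + P.η * P.failCount f (r, s) x) := by
          refine Finset.sum_le_sum fun x _ =>
            mul_le_mul_of_nonneg_left ?_ (weight_nonneg hw x)
          have h := hG2 (rep x) (x r)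
          simp only [rep, base_update, hit_update, lineFun_update] at h
          refine le_trans (le_of_eq ?_) h
          rw [lineFun_self]
          have : f x - sgn s * (G (rep x) (x r) + P.c r s (x r)) =
              sgn s * (sgn s * f x - P.c r s (x r) - G (rep x) (x r)) := by
            rw [sub_sub, mul_sub, sgn_mul_sgn_mul, add_comm (P.c r s (x r))]
          rw [this, abs_mul, abs_sgn, one_mul]
      _ = _ := by
          simp only [mul_add, Finset.sum_add_distrib]
          rw [← Finset.sum_mul, sum_weight hP.sum_w, one_mul, Finset.mul_sum]
          congr 1
          exact Finset.sum_congr rfl fun x _ => by ring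

/-- If the trials rarely fail, the function is close to one with all constraints. -/
theorem Valid.exists_l1Dist_le (hP : P.Valid) {f : Grid n d → ℝ}
    (hf : ∀ x, |f x - P.m x| ≤ P.R) :
    ∃ g, (∀ r s, Sat P.c r s g) ∧ (∀ x, |g x - P.m x| ≤ P.R) ∧
      l1Dist P.w f g ≤ 4 * d * P.η + 8 * d * P.R *
        ∑ ω, P.trialWeight ω * (if P.pass f ω then 0 else 1) := by
  obtain ⟨g, h1, -, h3, h4⟩ := LpTesting.exists_sat_l1Dist_le hP.w_pos hP.sum_w hP.antitone_c
    hP.sat_m _ Finset.univ f hf (hP.exists_sat_l1Dist_le hf)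
  refine ⟨g, fun r s => h1 (r, s) (Finset.mem_univ _), h3, h4.trans (le_of_eq ?_)⟩
  have hd : (0 : ℝ) < d := Nat.cast_pos.2 hP.dim_pos
  have hM : (0 : ℝ) < P.M := Nat.cast_pos.2 hP.M_pos
  rw [sum_trialWeight_mul_pass, Finset.sum_add_distrib, ← Finset.mul_sum]
  simp only [Finset.sum_const, Finset.card_univ, Fintype.card_fin, Fintype.card_prod,
    Fintype.card_bool, nsmul_eq_mul]
  -- The `2 * d` constraints and the factor 2 of the dimension reduction give `4 * d * η`; the
  -- failure counts give `4 * d * η * M = 8 * d * R` times the failure probability.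
  have hR : P.R = P.η * P.M / 2 := by linarith [hP.two_mul_R]
  rw [hR]
  push_cast
  field_simp
  ring

/-- Under the constraints every threshold set is monotone, so the forced values are correct: the
error is one-sided. -/
theorem Valid.pass_of_sat (hP : P.Valid) {f : Grid n d → ℝ} (hf : ∀ r s, Sat P.c r s f)
    (ω : P.Trial) : P.pass f ω = true := by
  rw [pass, beq_iff_eq, guess_eq (fun k => (hP.w_pos _ k).le) ?_ (P.level_mem ω)]
  intro k k' hk
  rw [Bool.le_iff_imp, hit_iff, hit_iff]
  exact fun h => h.trans (hf _ _ _ hk)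

end TesterData

/-! ### The tester -/

section Tester
variable {n d : ℕ} [NeZero n] {P : TesterData n d}

/-- The tester: `q` independent trials, cut off after `54 q` instructions. -/
noncomputable def tester (hP : P.Valid) (q : ℕ) : Algo (Grid n d) :=
  -- All choices of all trials are drawn by one instruction, which costs one unit of time.
  .sample (pmfOfReal
    (fun o => ∏ l, P.trialWeight ((Fintype.equivFin (Fin q → P.Trial)).symm o l))
    (fun _ => Finset.prod_nonneg fun _ _ => hP.trialWeight_nonneg _)
    ((Equiv.sum_comp (Fintype.equivFin (Fin q → P.Trial)).symm
      fun ω => ∏ l, P.trialWeight (ω l)).trans (sum_prod_eq_one hP.sum_trialWeight)))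
    fun o => (P.trialsAlgo (List.ofFn ((Fintype.equivFin (Fin q → P.Trial)).symm o))).trunc
      (54 * q)

theorem time_tester_le (hP : P.Valid) (q : ℕ) : (tester hP q).time ≤ 54 * q + 1 :=
  Nat.succ_le_succ (Finset.sup_le fun _ _ => Algo.time_trunc_le _ _)

theorem tester_accepts (hP : P.Valid) (q : ℕ) {f : Grid n d → ℝ} (hf : ∀ r s, Sat P.c r s f) :
    2 / 3 ≤ ((tester hP q).verdict f true).toReal := by
  refine le_trans ?_ (sum_le_verdict_sample _ _ _ f true (fun _ => 1) fun o => ?_)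
  · simp only [mul_one]
    rw [Equiv.sum_comp (Fintype.equivFin (Fin q → P.Trial)).symm
      fun ω => ∏ l, P.trialWeight (ω l), sum_prod_eq_one hP.sum_trialWeight]
    norm_num
  · have h := P.outcome_trialsAlgo (f := f) (fun r k => (hP.w_pos r k).le)
      (List.ofFn ((Fintype.equivFin (Fin q → P.Trial)).symm o))
    have hall : (List.ofFn ((Fintype.equivFin (Fin q → P.Trial)).symm o)).all (P.pass f) =
        true := List.all_eq_true.2 fun ω _ => hP.pass_of_sat hf ω
    rw [hall] at h
    rw [Algo.verdict, h _ _ (Or.inr rfl)]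
    simp

theorem tester_rejects (hP : P.Valid) {q : ℕ} {f : Grid n d → ℝ} {κ : ℝ}
    (hκ : κ ≤ ∑ ω, P.trialWeight ω * if P.pass f ω then 0 else 1) (hq : 5 ≤ κ * q)
    (hq0 : 0 < q) : 2 / 3 ≤ ((tester hP q).verdict f false).toReal := by
  classical
  have main := two_thirds_le_sum_prod hP.trialWeight_nonneg hP.sum_trialWeight hκ
    (hP.sum_trialWeight_mul_cost_le f) hq hq0
  rw [← Equiv.sum_comp (Fintype.equivFin (Fin q → P.Trial)).symm] at main
  refine main.trans (sum_le_verdict_sample _ _ _ f false _ fun o => ?_)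
  split_ifs with ho
  · have h := P.outcome_trialsAlgo (f := f) (fun r k => (hP.w_pos r k).le)
      (List.ofFn ((Fintype.equivFin (Fin q → P.Trial)).symm o))
    have hall : (List.ofFn ((Fintype.equivFin (Fin q → P.Trial)).symm o)).all (P.pass f) =
        false := by
      obtain ⟨l, hl⟩ := ho.1
      exact List.all_eq_false.2 ⟨_, (List.mem_ofFn' _ _).2 ⟨l, rfl⟩, by simp [hl]⟩
    rw [hall, List.map_ofFn, List.sum_ofFn] at h
    rw [Algo.verdict, h _ _ (Or.inl ho.2)]
    simp
  · exact ENNReal.toReal_nonneg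

end Tester

/-! ### From L_p under the given distribution to weighted L₁ -/

section Distance
variable {n d : ℕ}

theorem sum_toReal_pmf (μ : PMF (Fin n)) : ∑ k, (μ k).toReal = 1 := by
  have h : ∑ k, μ k = 1 := by rw [← tsum_fintype (L := .unconditional _), PMF.tsum_coe]
  rw [← ENNReal.toReal_sum fun k _ => PMF.apply_ne_top _ _, h, ENNReal.toReal_one]

/-- The distributions of the coordinates, mixed with a small multiple of the uniform one. -/
noncomputable def mixed (D : Fin d → PMF (Fin n)) (r : Fin d) (k : Fin n) : ℝ :=
  (1 - 1 / (2 * d)) * (D r k).toReal + 1 / (2 * d) / n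

theorem one_half_le_mix_coeff (hd : 0 < d) : (1 / 2 : ℝ) ≤ 1 - 1 / (2 * d) := by
  have hd' : (1 : ℝ) ≤ d := Nat.one_le_cast.2 hd
  have : 1 / (2 * d : ℝ) ≤ 1 / 2 := one_div_le_one_div_of_le (by norm_num) (by linarith)
  linarith

theorem mixed_pos (hn : 0 < n) (hd : 0 < d) (D : Fin d → PMF (Fin n)) (r : Fin d) (k : Fin n) :
    0 < mixed D r k := by
  have h1 := one_half_le_mix_coeff hd
  have h2 : (0 : ℝ) ≤ (D r k).toReal := ENNReal.toReal_nonneg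
  have : (0 : ℝ) < 1 / (2 * d) / n := by positivity
  have := mul_nonneg (by linarith : (0 : ℝ) ≤ 1 - 1 / (2 * d)) h2
  unfold mixed
  linarith

theorem sum_mixed (hn : 0 < n) (D : Fin d → PMF (Fin n)) (r : Fin d) :
    ∑ k, mixed D r k = 1 := by
  have hn' : (n : ℝ) ≠ 0 := Nat.cast_ne_zero.2 hn.ne'
  simp only [mixed, Finset.sum_add_distrib, ← Finset.mul_sum, sum_toReal_pmf, Finset.sum_const,
    Finset.card_univ, Fintype.card_fin, nsmul_eq_mul]
  rw [mul_div_cancel₀ _ hn']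
  ring

/-- Mixing in only `1 / (2 * d)` of the uniform distribution makes all weights positive, as the
regression requires, yet by Bernoulli's inequality `(1 - 1 / (2 * d)) ^ d ≥ 1 / 2`. -/
theorem prodMass_le (hd : 0 < d) (D : Fin d → PMF (Fin n)) (x : Grid n d) :
    prodMass D x ≤ 2 * weight (mixed D) x := by
  have h1 := one_half_le_mix_coeff hd
  have hd' : (0 : ℝ) < d := Nat.cast_pos.2 hd
  have h2 : (1 / 2 : ℝ) ≤ (1 - 1 / (2 * d)) ^ d := by
    have := one_add_mul_le_pow (a := -(1 / (2 * d : ℝ))) (by linarith) d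
    rw [← sub_eq_add_neg] at this
    refine le_trans (le_of_eq ?_) this
    field_simp
    norm_num
  have h3 : (1 - 1 / (2 * d : ℝ)) ^ d * prodMass D x ≤ weight (mixed D) x := by
    have : (1 - 1 / (2 * d : ℝ)) ^ d * prodMass D x =
        ∏ i, ((1 - 1 / (2 * d : ℝ)) * (D i (x i)).toReal) := by
      rw [Finset.prod_mul_distrib, Finset.prod_const, Finset.card_univ, Fintype.card_fin, prodMass]
    rw [this]
    refine Finset.prod_le_prod (fun i _ => mul_nonneg (by linarith) ENNReal.toReal_nonneg)
      fun i _ => ?_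
    have : (0 : ℝ) ≤ 1 / (2 * d) / n := by positivity
    unfold mixed
    linarith
  have h4 : 0 ≤ prodMass D x := Finset.prod_nonneg fun i _ => ENNReal.toReal_nonneg
  nlinarith

theorem prodMass_nonneg (D : Fin d → PMF (Fin n)) (x : Grid n d) : 0 ≤ prodMass D x :=
  Finset.prod_nonneg fun _ _ => ENNReal.toReal_nonneg

theorem lpDist_nonneg {p : ℕ} {a b : ℝ} (hab : a < b) (D : Fin d → PMF (Fin n))
    (f g : Grid n d → ℝ) : 0 ≤ lpDist p a b D f g :=
  mul_nonneg (one_div_nonneg.2 (sub_nonneg.2 hab.le)) (Real.rpow_nonneg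
    (Finset.sum_nonneg fun x _ => mul_nonneg (prodMass_nonneg D x) (by positivity)) _)

/-- One factor 2 is lost in mixing; the other comes from `|f - g| ^ 2 ≤ 2 * (b - a) * |f - g|` and
is needed only for `p = 2`. -/
theorem lt_l1Dist_of_lt_lpDistTo (hd : 0 < d) {p : ℕ} (hp : p = 1 ∨ p = 2) {a b ε : ℝ}
    (hab : a < b) (hε : 0 < ε) {D : Fin d → PMF (Fin n)} {S : Set (Grid n d → ℝ)}
    {f g : Grid n d → ℝ} (hg : g ∈ S) (hfg : ∀ x, |f x - g x| ≤ 2 * (b - a))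
    (h : ε < lpDistTo p a b D S f) : ε ^ p * (b - a) < 4 * l1Dist (mixed D) f g := by
  have hR : 0 < b - a := sub_pos.2 hab
  have h1 : ε < lpDist p a b D f g :=
    h.trans_le (ciInf_le ⟨0, by rintro _ ⟨g, rfl⟩; exact lpDist_nonneg hab D f g⟩ (⟨g, hg⟩ : S))
  have hp0 : p ≠ 0 := by rcases hp with rfl | rfl <;> norm_num
  have h2 : (ε * (b - a)) ^ p < ∑ x, prodMass D x * |f x - g x| ^ p := by
    by_contra! hle
    have h3 := Real.rpow_le_rpow (Finset.sum_nonneg fun x _ =>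
      mul_nonneg (prodMass_nonneg D x) (by positivity)) hle
      (by positivity : (0 : ℝ) ≤ 1 / (p : ℝ))
    rw [one_div, Real.pow_rpow_inv_natCast (by positivity) hp0] at h3
    rw [lpDist, one_div_mul_eq_div, lt_div_iff₀ hR, one_div] at h1
    linarith
  have h3 : ∑ x, prodMass D x * |f x - g x| ≤ 2 * l1Dist (mixed D) f g := by
    rw [l1Dist, Finset.mul_sum]
    refine Finset.sum_le_sum fun x _ => ?_
    rw [← mul_assoc]
    exact mul_le_mul_of_nonneg_right (prodMass_le hd D x) (abs_nonneg _)
  rcases hp with rfl | rfl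
  · simp only [pow_one] at h2 ⊢
    have : 0 ≤ ∑ x, prodMass D x * |f x - g x| :=
      Finset.sum_nonneg fun x _ => mul_nonneg (prodMass_nonneg D x) (abs_nonneg _)
    linarith
  · have h4 : ∑ x, prodMass D x * |f x - g x| ^ 2 ≤
        2 * (b - a) * ∑ x, prodMass D x * |f x - g x| := by
      rw [Finset.mul_sum]
      refine Finset.sum_le_sum fun x _ => ?_
      rw [mul_left_comm, sq]
      exact mul_le_mul_of_nonneg_left (mul_le_mul_of_nonneg_right (hfg x) (abs_nonneg _))
        (prodMass_nonneg D x)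
    rw [mul_pow] at h2
    have h5 : (ε ^ 2 * (b - a)) * (b - a) < (4 * l1Dist (mixed D) f g) * (b - a) := by
      nlinarith
    exact lt_of_mul_lt_mul_right h5 hR.le

end Distance

end LpTesting

/-! ### Choice of constants -/

theorem theorem2 (Sl Su : Finset ℝ) (p : ℕ) (hp : p = 1 ∨ p = 2) :
    ∃ C : ℝ, 0 < C ∧
      ∀ (n d : ℕ), 0 < n → 0 < d →
      ∀ B : LpTesting.BoundingFamily n d,
        (∀ r y, B.lower r y ∈ Sl) → (∀ r y, B.upper r y ∈ Su) →
      ∀ (D : Fin d → PMF (Fin n)) (a b : ℝ), a < b →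
      ∀ ε : ℝ, 0 < ε → ε < 1 →
        ∃ T : LpTesting.Algo (LpTesting.Grid n d),
          (T.time : ℝ) ≤ C * (d / ε ^ p) ∧
          LpTesting.IsLpTester p a b ε D B.property T := by
  -- The time is at most `54 * q + 1` with `q < 320 * (d / ε ^ p) + 1`, and `54 * 320 + 54 + 1 =
  -- 17335`, using `1 ≤ d / ε ^ p`.
  refine ⟨17335, by norm_num, fun n d hn hd B _ _ D a b hab ε hε hε1 => ?_⟩
  have : NeZero n := ⟨hn.ne'⟩
  have hd' : (1 : ℝ) ≤ d := Nat.one_le_cast.2 hd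
  have hεp : 0 < ε ^ p := pow_pos hε p
  have hR : 0 < b - a := sub_pos.2 hab
  have hone : 1 ≤ d / ε ^ p := by
    rw [le_div_iff₀ hεp, one_mul]
    exact (pow_le_one₀ hε.le hε1.le).trans hd'
  by_cases hm : ∃ m ∈ B.property, ∀ x, m x ∈ Set.Icc a b
  · obtain ⟨m, hmB, hmab⟩ := hm
    -- Large enough for the rounding error to use up at most half of the distance.
    set M := ⌈64 * (d / ε ^ p)⌉₊
    have hM : 64 * (d / ε ^ p) ≤ M := Nat.le_ceil _
    have hM0 : (0 : ℝ) < M := by linarith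
    let P : LpTesting.TesterData n d :=
      { w := LpTesting.mixed D, c := B.offset, m := m, R := b - a, η := 2 * (b - a) / M, M := M }
    have hP : P.Valid :=
      { dim_pos := hd
        w_pos := LpTesting.mixed_pos hn hd D
        sum_w := LpTesting.sum_mixed hn D
        antitone_c := B.antitone_offset
        sat_m := (B.mem_property_iff m).1 hmB
        η_pos := div_pos (by linarith) hM0
        M_pos := Nat.cast_pos.1 hM0
        two_mul_R := (div_mul_cancel₀ _ hM0.ne').symm }
    -- Five times the reciprocal of the failure probability `ε ^ p / (64 * d)`.
    set q := ⌈320 * (d / ε ^ p)⌉₊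
    have hq : 320 * (d / ε ^ p) ≤ q := Nat.le_ceil _
    have hq1 : (q : ℝ) < 320 * (d / ε ^ p) + 1 := Nat.ceil_lt_add_one (by linarith)
    refine ⟨LpTesting.tester hP q, ?_, fun f hf => ⟨fun hfB =>
      LpTesting.tester_accepts hP q ((B.mem_property_iff f).1 hfB), fun hfar => ?_⟩⟩
    · have := LpTesting.time_tester_le hP q
      have h' : ((LpTesting.tester hP q).time : ℝ) ≤ 54 * q + 1 := by exact_mod_cast this
      linarith
    · have hfm : ∀ x, |f x - P.m x| ≤ P.R := fun x =>
        abs_sub_le_iff.2 ⟨by linarith [(hf x).2, (hmab x).1], by linarith [(hf x).1, (hmab x).2]⟩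
      obtain ⟨g, hg, hgm, hfg⟩ := hP.exists_l1Dist_le hfm
      have hlt := LpTesting.lt_l1Dist_of_lt_lpDistTo hd hp hab hε
        ((B.mem_property_iff g).2 hg) (fun x => by
          have h1 := abs_sub_le_iff.1 (hfm x)
          have h2 := abs_sub_le_iff.1 (hgm x)
          exact abs_sub_le_iff.2 ⟨by linarith, by linarith⟩) hfar
      refine LpTesting.tester_rejects hP (κ := 1 / (64 * (d / ε ^ p))) ?_ ?_
        (Nat.cast_pos.1 (by linarith : (0 : ℝ) < q))
      · set φ := ∑ ω, P.trialWeight ω * (if P.pass f ω then (0 : ℝ) else 1)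
        have hlt' : ε ^ p * (b - a) <
            4 * (4 * d * (2 * (b - a) / M) + 8 * d * (b - a) * φ) := hlt.trans_le
          (mul_le_mul_of_nonneg_left hfg (by norm_num))
        have h1 : ε ^ p < 32 * d * (1 / M + φ) := by
          refine lt_of_mul_lt_mul_right (hlt'.trans_le (le_of_eq ?_)) hR.le
          ring
        have h2 : (1 : ℝ) / M ≤ 1 / (64 * (d / ε ^ p)) :=
          one_div_le_one_div_of_le (by linarith) hM
        have h3 : 1 / (64 * (d / ε ^ p)) = ε ^ p / (64 * d) := by
          field_simp
        have h4 : ε ^ p / (32 * d) < 1 / M + φ := by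
          rw [div_lt_iff₀ (by linarith)]; linarith
        have h5 : ε ^ p / (32 * d) = 2 * (ε ^ p / (64 * d)) := by field_simp; norm_num
        rw [h3] at h2 ⊢
        linarith
      · rw [one_div_mul_eq_div, le_div_iff₀ (by linarith)]
        linarith
  -- No function with values in `[a, b]` has the property, so nothing ever has to be accepted.
  · refine ⟨.reject, ?_, fun f hf => ⟨fun hfB => absurd ⟨f, hfB, hf⟩ hm, fun _ => ?_⟩⟩
    · simp only [LpTesting.Algo.time, Nat.cast_zero]
      linarith
    · simp only [LpTesting.Algo.verdict, LpTesting.Algo.run, PMF.pure_apply]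
      norm_num
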